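/- Let $I\subset\mathbb{R}$ be a bounded nondegenerate interval and write $\langle\psi\rangle_J=\frac1{|J|}\int_J\psi$. A real-valued $\varphi\in L^1(I)$ belongs to $\mathrm{BMO}(I)$ if $$\|\varphi\|_{\mathrm{BMO}(I)}=\Big(\sup_{J}\big\langle|\varphi-\langle\varphi\rangle_J|^2\big\rangle_J\Big)^{1/2}<\infty,$$ where the supremum is over all nondegenerate subintervals $J\subseteq I$. Let $p\ge 1$ and $\max(2,p)\le r<\infty$. Then every $\varphi\in\mathrm{BMO}(I)$ with $\langle\varphi\rangle_I=0$ lies in $L^r(I)$ and satisfies $$\|\varphi\|_{L^r(I)}\le\Big(\frac{\Gamma(r+1)}{\Gamma(p+1)}\Big)^{\frac1r}\|\varphi\|_{L^p(I)}^{\frac pr}\,\|\varphi\|_{\mathrm{BMO}(I)}^{1-\frac pr}$$ (with the convention $0^0=1$). For every such $I$, $p$, $r$ the constant $\big(\Gamma(r+1)/\Gamma(p+1)\big)^{1/r}$ is the smallest one for which this inequality holds for all $\varphi\in\mathrm{BMO}(I)$ with $\langle\varphi\rangle_I=0$. Moreover, on $I=(-2,2)$ the function $$\varphi_0(t)=\begin{cases}-\ln(2-t),&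 t\in[1,2),\\ 0,& t\in[-1,1],\\ \ln(t+2),& t\in(-2,-1],\end{cases}$$ is a nonzero element of $\mathrm{BMO}(I)$ with $\langle\varphi_0\rangle_I=0$, and the inequality is an equality for $\varphi_0$. -/

import Mathlib

open MeasureTheory
open scoped ENNReal

/-- A bounded nondegenerate interval of the real line (the endpoints may or may not belong to it). -/
def IsBoundedInterval (I : Set ℝ) : Prop :=
  I.OrdConnected ∧ Bornology.IsBounded I ∧ (interior I).Nonempty

/-- The quadratic `BMO` seminorm on `I`: the square root of the supremum, over all subintervals `J`
of `I`, of the average over `J` of `|φ - ⟨φ⟩_J|²`; it may be infinite. -/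
noncomputable def bmoSeminorm (φ : ℝ → ℝ) (I : Set ℝ) : ℝ≥0∞ :=
  (⨆ (J : Set ℝ) (_ : IsBoundedInterval J ∧ J ⊆ I),
    ⨍⁻ t in J, ‖φ t - ⨍ s in J, φ s‖ₑ ^ 2 ∂volume) ^ (1 / 2 : ℝ)

/-- `φ ∈ BMO(I)`: `φ` is integrable on `I` with finite quadratic `BMO` seminorm. -/
def MemBMO (φ : ℝ → ℝ) (I : Set ℝ) : Prop :=
  IntegrableOn φ I ∧ bmoSeminorm φ I < ∞

/-- The norm of `L^q(I)`, for a real exponent `q`, with respect to Lebesgue measure. -/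
noncomputable def lpNormOn (φ : ℝ → ℝ) (q : ℝ) (I : Set ℝ) : ℝ≥0∞ :=
  eLpNorm φ (ENNReal.ofReal q) (volume.restrict I)

/-- The constant `(Γ(r+1) / Γ(p+1))^(1/r)`. -/
noncomputable def multConst (p r : ℝ) : ℝ :=
  (Real.Gamma (r + 1) / Real.Gamma (p + 1)) ^ (1 / r)

/-- The extremal function, to be considered on the interval `(-2, 2)` only. -/
noncomputable def phiZero (t : ℝ) : ℝ :=
  if 1 ≤ t then -Real.log (2 - t) else if -1 ≤ t then 0 else Real.log (t + 2)

/-! Scale the seminorm to one and put T(c) = ∫ (|φ| - c)₊² / 2. The heart of the matter is the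
differential inequality T(c) ≤ ∫ (|φ| - c)₊ = -T'(c) for c ≥ 0, which says that e^c T(c) is
nonincreasing.

It is proved separately for φ and -φ. Shifting by c + 1 gives ψ with nonpositive mean, and the claim
becomes that `excess` of ψ has nonpositive integral. The rising sun lemma, applied to the primitive
of ψ, splits the interval into components on which ψ has mean zero, where the BMO bound gives
quadratic mean at most one, and a remainder where ψ ≤ 0 almost everywhere. The excess is controlled
on both (`setIntegral_excess_nonpos`, `tailSq_le_of_oscillation`).

For q > 2, the moment ∫ |φ|^q / Γ(q+1) is the average of e^c T(c) under the Gamma law of shape q -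
2. These laws increase stochastically with the shape, so the normalised moments decrease in q. The
value at q = 2 is T(0), and for 1 < p < 2 a version of the formula with T(0) - T(c) gives the
comparison with T(0); p = 1 is the differential inequality at c = 0 (`lintegral_rpow_div_Gamma_le`).
Undoing the scaling yields the inequality with its constant.

For φ₀ the substitution s = -ln(2 - t) turns moments into Gamma integrals, so they have exactly the
required ratio. An explicit primitive of (φ₀ - k)² - 1 shows that the seminorm is at most one, and
affine copies give sharpness on every interval. -/

section

open Set Filter Topology

/-! ### Rising sun estimate for the excess -/

/-- To bound the integral over a bounded open set it suffices to bound it over each component. -/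
theorem setIntegral_nonpos_of_components {U : Set ℝ} (hU : IsOpen U) {L R : ℝ} (hb : U ⊆ Ioo L R)
    {F : ℝ → ℝ} (hF : IntegrableOn F U)
    (h : ∀ α β, α < β → Ioo α β ⊆ U → α ∉ U → β ∉ U → ∫ t in Ioo α β, F t ≤ 0) :
    ∫ t in U, F t ≤ 0 := by
  set 𝒞 : Set (Set ℝ) :=
    {s | ∃ α β, α < β ∧ s = Ioo α β ∧ Ioo α β ⊆ U ∧ α ∉ U ∧ β ∉ U} with h𝒞
  have hdisj : 𝒞.PairwiseDisjoint id := by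
    rintro s ⟨α, β, h1, rfl, h2, h3, h4⟩ s' ⟨α', β', h1', rfl, h2', h3', h4'⟩ hne
    by_contra hnd
    obtain ⟨z, hz, hz'⟩ := Set.not_disjoint_iff.1 hnd
    simp only [id, mem_Ioo] at hz hz'
    apply hne
    have e1 : α = α' := by
      rcases lt_trichotomy α α' with hlt | heq | hlt
      · exact absurd (h2 ⟨hlt, by linarith⟩) h3'
      · exact heq
      · exact absurd (h2' ⟨hlt, by linarith⟩) h3
    have e2 : β = β' := by
      rcases lt_trichotomy β β' with hlt | heq | hlt
      · exact absurd (h2' ⟨by linarith, hlt⟩) h4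
      · exact heq
      · exact absurd (h2 ⟨by linarith, hlt⟩) h4'
    rw [e1, e2]
  have hcount : 𝒞.Countable := by
    apply hdisj.countable_of_isOpen
    · rintro s ⟨α, β, h1, rfl, -⟩; exact isOpen_Ioo
    · rintro s ⟨α, β, h1, rfl, -⟩; exact nonempty_Ioo.2 h1
  have hunion : U = ⋃ s : 𝒞, (s : Set ℝ) := by
    rw [← sUnion_eq_iUnion]
    apply Subset.antisymm
    · intro x hx
      have hLx := (hb hx).1
      have hxR := (hb hx).2
      -- The component of `x` ends at the nearest points of the complement on either side; `L` and
      -- `R` lie outside `U`, so both searches are over nonempty compact sets.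
      obtain ⟨α, hα, hα'⟩ := (isCompact_Icc.inter_right hU.isClosed_compl).exists_isGreatest
        (⟨L, ⟨le_rfl, hLx.le⟩, fun h => lt_irrefl _ (hb h).1⟩ : (Icc L x ∩ Uᶜ).Nonempty)
      obtain ⟨β, hβ, hβ'⟩ := (isCompact_Icc.inter_right hU.isClosed_compl).exists_isLeast
        (⟨R, ⟨hxR.le, le_rfl⟩, fun h => lt_irrefl _ (hb h).2⟩ : (Icc x R ∩ Uᶜ).Nonempty)
      have hαx : α < x := lt_of_le_of_ne hα.1.2 (fun h => hα.2 (h ▸ hx))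
      have hxβ : x < β := lt_of_le_of_ne hβ.1.1 (fun h => hβ.2 (h ▸ hx))
      refine ⟨Ioo α β, ⟨α, β, hαx.trans hxβ, rfl, ?_, hα.2, hβ.2⟩, hαx, hxβ⟩
      intro y hy
      by_contra hyU
      rcases le_total y x with hyx | hyx
      · have := hα' ⟨⟨hα.1.1.trans hy.1.le, hyx⟩, hyU⟩
        exact absurd hy.1 (not_lt.2 this)
      · have := hβ' ⟨⟨hyx, hy.2.le.trans hβ.1.2⟩, hyU⟩
        exact absurd hy.2 (not_lt.2 this)
    · rintro x ⟨s, ⟨α, β, h1, rfl, h2, -⟩, hx⟩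
      exact h2 hx
  have : Countable 𝒞 := hcount
  rw [hunion] at hF ⊢
  rw [integral_iUnion _ _ hF]
  · apply tsum_nonpos
    rintro ⟨s, α, β, h1, rfl, h2, h3, h4⟩
    exact h α β h1 h2 h3 h4
  · rintro ⟨s, α, β, h1, rfl, -⟩; exact measurableSet_Ioo
  · intro s s' hne
    exact hdisj s.2 s'.2 (fun h => hne (Subtype.ext h))

/-- The excess function whose average is controlled by the rising sun argument. -/
noncomputable def excess (x : ℝ) : ℝ := max (x + 1) 0 ^ 2 / 2 - max (x + 1) 0

/-- Equality for x ≥ -1; below that the left side vanishes and the right side is nonnegative. This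
is how a second-moment bound controls the excess. -/
theorem excess_le (x : ℝ) : excess x ≤ (x ^ 2 - 1) / 2 := by
  unfold excess
  rcases le_total (x + 1) 0 with h | h
  · rw [max_eq_right h]; nlinarith
  · rw [max_eq_left h]; nlinarith

theorem excess_nonpos {x : ℝ} (hx : x ≤ 1) : excess x ≤ 0 := by
  unfold excess
  rcases le_total (x + 1) 0 with h | h
  · rw [max_eq_right h]; norm_num
  · rw [max_eq_left h]; nlinarith

theorem continuous_excess : Continuous excess := by
  unfold excess; fun_prop

theorem integrable_excess {α : Type*} [MeasurableSpace α] {μ : Measure α} [IsFiniteMeasure μ]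
    {ψ : α → ℝ} (h1 : Integrable ψ μ) (h2 : Integrable (fun t => ψ t ^ 2) μ) :
    Integrable (fun t => excess (ψ t)) μ := by
  refine Integrable.mono' (g := fun t => ψ t ^ 2 + 2 * |ψ t| + 2) ?_
    (continuous_excess.comp_aestronglyMeasurable h1.aestronglyMeasurable) (ae_of_all _ fun t => ?_)
  · exact (h2.add (h1.abs.const_mul 2)).add (integrable_const _)
  · have := le_abs_self (ψ t)
    have := neg_abs_le (ψ t)
    have h3 := sq_abs (ψ t)
    rw [Real.norm_eq_abs, abs_le]
    unfold excess
    rcases le_total (ψ t + 1) 0 with h | h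
    · rw [max_eq_right h]; constructor <;> nlinarith [abs_nonneg (ψ t)]
    · rw [max_eq_left h]; constructor <;> nlinarith [abs_nonneg (ψ t)]

/-- If the quadratic mean of `ψ` over an interval is at most one, its excess has nonpositive
integral there. -/
theorem setIntegral_excess_nonpos_of_sq {α β : ℝ} {ψ : ℝ → ℝ} (hαβ : α ≤ β)
    (h1 : IntegrableOn ψ (Ioo α β)) (h2 : IntegrableOn (fun t => ψ t ^ 2) (Ioo α β))
    (h : ∫ t in Ioo α β, ψ t ^ 2 ≤ β - α) : ∫ t in Ioo α β, excess (ψ t) ≤ 0 := by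
  have hi : IntegrableOn (fun t => (ψ t ^ 2 - 1) / 2) (Ioo α β) :=
    (h2.sub (integrableOn_const (by simp))).div_const 2
  calc ∫ t in Ioo α β, excess (ψ t) ≤ ∫ t in Ioo α β, (ψ t ^ 2 - 1) / 2 :=
        integral_mono (integrable_excess h1 h2) hi (fun t => excess_le _)
    _ = ((∫ t in Ioo α β, ψ t ^ 2) - (β - α)) / 2 := by
        rw [integral_div, integral_sub h2 (integrableOn_const (by simp))]
        simp [Real.volume_real_Ioo_of_le hαβ]
    _ ≤ 0 := by linarith

/-- The rising sun lemma: on a component of the shadow the function takes a larger value at the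
right endpoint. -/
theorem rising_sun_component {f : ℝ → ℝ} {a b : ℝ} (hf : ContinuousOn f (Icc a b)) {α β : ℝ}
    (hαβ : α < β)
    (hsub : Ioo α β ⊆ {t | t ∈ Ioo a b ∧ ∃ s ∈ Ioc t b, f t < f s})
    (hβ : β ∉ {t | t ∈ Ioo a b ∧ ∃ s ∈ Ioc t b, f t < f s}) (ha : a ≤ α) (hb : β ≤ b) :
    f α ≤ f β := by
  have key : ∀ t ∈ Ioo α β, f t ≤ f β := by
    intro t ht
    -- Take a maximum point of `f` on [t, β]. If it is not β, it lies in the shadow, so a larger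
    -- value occurs beyond β; that value also exceeds f β and would put β in the shadow.
    have hIcc : Icc t β ⊆ Icc a b := Icc_subset_Icc (ha.trans ht.1.le) hb
    obtain ⟨x, hx, hmax⟩ := isCompact_Icc.exists_isMaxOn (nonempty_Icc.2 ht.2.le) (hf.mono hIcc)
    rcases hx.2.eq_or_lt with rfl | hlt
    · exact hmax (left_mem_Icc.2 hx.1)
    · obtain ⟨-, s, hs, hfs⟩ := hsub ⟨ht.1.trans_le hx.1, hlt⟩
      have hsβ : β < s := by
        by_contra hle
        exact absurd (hmax ⟨hx.1.trans hs.1.le, not_lt.1 hle⟩) (not_le.2 hfs)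
      have hβx : f β ≤ f x := hmax (right_mem_Icc.2 ht.2.le)
      exact absurd ⟨⟨ha.trans_lt hαβ, hsβ.trans_le hs.2⟩, s, ⟨hsβ, hs.2⟩, hβx.trans_lt hfs⟩ hβ
  have hc : ContinuousWithinAt f (Ioo α β) α :=
    (hf α ⟨ha, hαβ.le.trans hb⟩).mono
      (Ioo_subset_Icc_self.trans (Icc_subset_Icc ha hb))
  have : (𝓝[Ioo α β] α).NeBot := left_nhdsWithin_Ioo_neBot hαβ
  exact le_of_tendsto hc (eventually_nhdsWithin_of_forall key)

theorem isOpen_shadow {f : ℝ → ℝ} {a b : ℝ} (hf : ContinuousOn f (Icc a b)) :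
    IsOpen {t | t ∈ Ioo a b ∧ ∃ s ∈ Ioc t b, f t < f s} := by
  rw [isOpen_iff_mem_nhds]
  rintro t ⟨ht, s, hs, hts⟩
  have hc : ContinuousAt f t := hf.continuousAt (Icc_mem_nhds ht.1 ht.2)
  filter_upwards [isOpen_Ioo.mem_nhds ht, hc.eventually (gt_mem_nhds hts),
    gt_mem_nhds hs.1] with x h1 h2 h3
  exact ⟨h1, s, ⟨h3, hs.2⟩, h2⟩

/-- Rising sun estimate when the primitive of `ψ` is nonpositive. -/
theorem setIntegral_excess_nonpos_of_primitive {a b : ℝ} {ψ : ℝ → ℝ} (hab : a ≤ b)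
    (h1 : IntegrableOn ψ (Ioo a b)) (h2 : IntegrableOn (fun t => ψ t ^ 2) (Ioo a b))
    (hprim : ∀ t ∈ Icc a b, ∫ s in a..t, ψ s ≤ 0)
    (hz : ∀ α β, a ≤ α → α < β → β ≤ b → ∫ t in Ioo α β, ψ t = 0 →
      ∫ t in Ioo α β, ψ t ^ 2 ≤ β - α) :
    ∫ t in Ioo a b, excess (ψ t) ≤ 0 := by
  set f : ℝ → ℝ := fun t => ∫ s in a..t, ψ s with hf
  have hi : IntervalIntegrable ψ volume a b :=
    (intervalIntegrable_iff_integrableOn_Ioo_of_le hab).2 h1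
  have hfc : ContinuousOn f (Icc a b) := by
    have := intervalIntegral.continuousOn_primitive_interval (a := a) (b := b) (f := ψ)
      (μ := volume) (by rw [uIcc_of_le hab]; exact ((integrableOn_Icc_iff_integrableOn_Ioo (by simp) (by simp)).2 h1))
    rwa [uIcc_of_le hab] at this
  set U : Set ℝ := {t | t ∈ Ioo a b ∧ ∃ s ∈ Ioc t b, f t < f s} with hU
  have hUo : IsOpen U := isOpen_shadow hfc
  have hUs : U ⊆ Ioo a b := fun t ht => ht.1
  have hex : IntegrableOn (fun t => excess (ψ t)) (Ioo a b) := integrable_excess h1 h2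
  have hUI : ∫ t in U, excess (ψ t) ≤ 0 := by
    refine setIntegral_nonpos_of_components hUo hUs (hex.mono_set hUs) ?_
    intro α β hαβ hsub hα hβ
    have hIcc : Icc α β ⊆ Icc a b := by
      rw [← closure_Ioo hαβ.ne]
      exact closure_minimal (hsub.trans (hUs.trans Ioo_subset_Icc_self)) isClosed_Icc
    have haα : a ≤ α := (hIcc (left_mem_Icc.2 hαβ.le)).1
    have hβb : β ≤ b := (hIcc (right_mem_Icc.2 hαβ.le)).2
    have hle : f α ≤ f β := rising_sun_component hfc hαβ hsub hβ haα hβb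
    -- Either α = a, where the primitive vanishes and dominates by `hprim`, or α is an interior
    -- point outside the shadow. So the primitive agrees at both ends and ψ has mean zero on the
    -- component.
    have hge : f β ≤ f α := by
      rcases haα.eq_or_lt with rfl | hlt
      · have : f a = 0 := by simp [hf]
        rw [this]; exact hprim β ⟨hαβ.le, hβb⟩
      · by_contra hlt'
        exact hα ⟨⟨hlt, hαβ.trans_le hβb⟩, β, ⟨hαβ, hβb⟩, not_le.1 hlt'⟩
    have hsubI : Ioo α β ⊆ Ioo a b := Ioo_subset_Ioo haα hβb
    have hzero : ∫ t in Ioo α β, ψ t = 0 := by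
      rw [← integral_Ioc_eq_integral_Ioo, ← intervalIntegral.integral_of_le hαβ.le]
      have e := intervalIntegral.integral_interval_sub_left (a := a) (b := β) (c := α)
        (μ := volume) (f := ψ)
        (hi.mono_set (by rw [uIcc_of_le hab, uIcc_of_le (haα.trans hαβ.le)]
                         exact Icc_subset_Icc_right hβb))
        (hi.mono_set (by rw [uIcc_of_le hab, uIcc_of_le haα]
                         exact Icc_subset_Icc_right (hαβ.le.trans hβb)))
      rw [← e]; simp only [hf] at hle hge; linarith
    exact setIntegral_excess_nonpos_of_sq hαβ.le (h1.mono_set hsubI) (h2.mono_set hsubI)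
      (hz α β haα hαβ hβb hzero)
  -- Outside the shadow no later value of `f` is larger, so by Lebesgue differentiation ψ ≤ 0 almost
  -- everywhere there.
  have hcompl : ∫ t in Ioo a b \ U, excess (ψ t) ≤ 0 := by
    apply setIntegral_nonpos_of_ae_restrict
    have hd := hi.ae_hasDerivAt_integral
    rw [EventuallyLE, ae_restrict_iff' (measurableSet_Ioo.diff hUo.measurableSet)]
    filter_upwards [hd] with t ht htm
    have hta := htm.1
    have hder := ht (by rw [uIcc_of_le hab]; exact Ioo_subset_Icc_self hta) a
      (by rw [uIcc_of_le hab]; exact left_mem_Icc.2 hab)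
    apply excess_nonpos
    refine le_trans ?_ zero_le_one
    have hlim := hder.hasDerivWithinAt (s := Ioi t)
    rw [hasDerivWithinAt_iff_tendsto_slope' (by simp)] at hlim
    refine le_of_tendsto hlim ?_
    filter_upwards [Ioo_mem_nhdsGT hta.2] with s hs
    rw [slope_def_field]
    apply div_nonpos_of_nonpos_of_nonneg _ (by linarith [hs.1])
    by_contra hpos
    exact htm.2 ⟨hta, s, ⟨hs.1, hs.2.le⟩, by simp only [hf]; linarith⟩
  rw [← union_sdiff_cancel hUs, setIntegral_union disjoint_sdiff_right
    (measurableSet_Ioo.diff hUo.measurableSet) (hex.mono_set hUs) (hex.mono_set sdiff_subset)]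
  linarith

/-- If `ψ` has nonpositive mean and every subinterval on which it has mean zero has quadratic mean
at most one, then the mean of the excess is nonpositive. -/
theorem setIntegral_excess_nonpos {a b : ℝ} {ψ : ℝ → ℝ} (hab : a ≤ b)
    (h1 : IntegrableOn ψ (Ioo a b)) (h2 : IntegrableOn (fun t => ψ t ^ 2) (Ioo a b))
    (hmean : ∫ t in Ioo a b, ψ t ≤ 0)
    (hz : ∀ α β, a ≤ α → α < β → β ≤ b → ∫ t in Ioo α β, ψ t = 0 →
      ∫ t in Ioo α β, ψ t ^ 2 ≤ β - α) :
    ∫ t in Ioo a b, excess (ψ t) ≤ 0 := by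
  set f : ℝ → ℝ := fun t => ∫ s in a..t, ψ s with hf
  have hi : IntervalIntegrable ψ volume a b :=
    (intervalIntegrable_iff_integrableOn_Ioo_of_le hab).2 h1
  have hfc : ContinuousOn f (Icc a b) := by
    have := intervalIntegral.continuousOn_primitive_interval (a := a) (b := b) (f := ψ)
      (μ := volume) (by rw [uIcc_of_le hab]; exact ((integrableOn_Icc_iff_integrableOn_Ioo (by simp) (by simp)).2 h1))
    rwa [uIcc_of_le hab] at this
  have hfb : f b ≤ 0 := by
    simp only [hf]
    rwa [intervalIntegral.integral_of_le hab, integral_Ioc_eq_integral_Ioo]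
  have hZ : IsCompact (Icc a b ∩ f ⁻¹' {0}) :=
    isCompact_Icc.of_isClosed_subset (hfc.preimage_isClosed_of_isClosed isClosed_Icc
      isClosed_singleton) inter_subset_left
  -- Cut at the last zero `c` of the primitive: ψ has mean zero before it, and after it the
  -- primitive cannot become positive, since `f b ≤ 0` would force another zero.
  obtain ⟨c, hc, hcmax⟩ := hZ.exists_isGreatest ⟨a, left_mem_Icc.2 hab, by simp [hf]⟩
  have hac : a ≤ c := hc.1.1
  have hcb : c ≤ b := hc.1.2
  have hfc0 : f c = 0 := hc.2
  have hic : IntervalIntegrable ψ volume a c := hi.mono_set (by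
    rw [uIcc_of_le hab, uIcc_of_le hac]; exact Icc_subset_Icc_right hcb)
  have hicb : ∀ t ∈ Icc c b, IntervalIntegrable ψ volume c t := fun t ht => hi.mono_set (by
    rw [uIcc_of_le hab, uIcc_of_le ht.1]; exact Icc_subset_Icc hac ht.2)
  have hprim : ∀ t ∈ Icc c b, ∫ s in c..t, ψ s ≤ 0 := by
    intro t ht
    have e := intervalIntegral.integral_add_adjacent_intervals hic (hicb t ht)
    have : ∫ s in c..t, ψ s = f t := by simp only [hf] at hfc0 ⊢; linarith
    rw [this]
    by_contra hpos
    obtain ⟨z, hz1, hz2⟩ := intermediate_value_Icc' ht.2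
      (hfc.mono (Icc_subset_Icc_left (hac.trans ht.1))) ⟨hfb, (not_le.1 hpos).le⟩
    have hzc : z ≤ c := hcmax ⟨⟨hac.trans (ht.1.trans hz1.1), hz1.2⟩, hz2⟩
    have : z = t := le_antisymm (hzc.trans ht.1) hz1.1
    rw [this] at hz2
    exact hpos hz2.le
  have hs1 : Ioo a c ⊆ Ioo a b := Ioo_subset_Ioo_right hcb
  have hs2 : Ioo c b ⊆ Ioo a b := Ioo_subset_Ioo_left hac
  have hex : IntegrableOn (fun t => excess (ψ t)) (Ioo a b) := integrable_excess h1 h2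
  have e1 : ∫ t in Ioo a c, excess (ψ t) ≤ 0 := by
    rcases hac.eq_or_lt with rfl | hlt
    · simp
    · refine setIntegral_excess_nonpos_of_sq hac (h1.mono_set hs1) (h2.mono_set hs1)
        (hz a c le_rfl hlt hcb ?_)
      rw [← integral_Ioc_eq_integral_Ioo, ← intervalIntegral.integral_of_le hac]
      exact hfc0
  have e2 : ∫ t in Ioo c b, excess (ψ t) ≤ 0 :=
    setIntegral_excess_nonpos_of_primitive hcb (h1.mono_set hs2) (h2.mono_set hs2) hprim
      (fun α β hα hαβ hβ => hz α β (hac.trans hα) hαβ hβ)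
  have hexi : IntervalIntegrable (fun t => excess (ψ t)) volume a b :=
    (intervalIntegrable_iff_integrableOn_Ioo_of_le hab).2 hex
  have e := intervalIntegral.integral_add_adjacent_intervals
    (hexi.mono_set (by rw [uIcc_of_le hab, uIcc_of_le hac]; exact Icc_subset_Icc_right hcb) :
      IntervalIntegrable (fun t => excess (ψ t)) volume a c)
    (hexi.mono_set (by rw [uIcc_of_le hab, uIcc_of_le hcb]; exact Icc_subset_Icc_left hac))
  rw [intervalIntegral.integral_of_le hab, intervalIntegral.integral_of_le hac,
    intervalIntegral.integral_of_le hcb, integral_Ioc_eq_integral_Ioo,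
    integral_Ioc_eq_integral_Ioo, integral_Ioc_eq_integral_Ioo] at e
  linarith

/-! ### Exponential decay of the quadratic tail -/

section Tail

variable {α : Type*} [MeasurableSpace α] {μ : Measure α} {X : α → ℝ}

/-- Half the second moment of the excess of `X` over the level `c`. -/
noncomputable def tailSq (μ : Measure α) (X : α → ℝ) (c : ℝ) : ℝ :=
  ∫ x, max (X x - c) 0 ^ 2 / 2 ∂μ

theorem tailSq_nonneg (c : ℝ) : 0 ≤ tailSq μ X c :=
  integral_nonneg fun _ => by positivity

theorem tailSq_zero (hX0 : ∀ x, 0 ≤ X x) : tailSq μ X 0 = ∫ x, X x ^ 2 / 2 ∂μ := by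
  simp [tailSq, hX0]

theorem lintegral_sq_div_Gamma (hX : MemLp X 2 μ) (hX0 : ∀ x, 0 ≤ X x) :
    ∫⁻ x, ENNReal.ofReal (X x ^ (2 : ℝ) / Real.Gamma (2 + 1)) ∂μ =
      ENNReal.ofReal (tailSq μ X 0) := by
  have hG : Real.Gamma (2 + 1) = 2 := by
    rw [Real.Gamma_add_one (by norm_num), Real.Gamma_two]; norm_num
  rw [tailSq_zero hX0, ofReal_integral_eq_lintegral_ofReal (hX.integrable_sq.div_const 2)
    (ae_of_all _ fun x => by dsimp only [Pi.zero_apply]; positivity), hG]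
  simp

variable [IsFiniteMeasure μ]

theorem memLp_tail (hX : MemLp X 2 μ) (c : ℝ) : MemLp (fun x => max (X x - c) 0) 2 μ :=
  (hX.sub (memLp_const c)).sup (memLp_const 0)

theorem integrable_tail (hX : MemLp X 2 μ) (c : ℝ) : Integrable (fun x => max (X x - c) 0) μ :=
  (memLp_tail hX c).integrable one_le_two

theorem integrable_tailSq (hX : MemLp X 2 μ) (c : ℝ) :
    Integrable (fun x => max (X x - c) 0 ^ 2 / 2) μ :=
  (memLp_tail hX c).integrable_sq.div_const 2

theorem antitone_tailSq (hX : MemLp X 2 μ) : Antitone (tailSq μ X) := by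
  intro s t hst
  refine integral_mono (integrable_tailSq hX t) (integrable_tailSq hX s) fun x => ?_
  dsimp only
  gcongr

/-- A discrete form of T ≤ -T' that avoids differentiating T: pointwise (y + u)² / 2 ≥ y² / 2 + u y
for y, u ≥ 0, and `H` bounds the integral of the linear term from below. -/
theorem one_add_mul_tailSq_le (hX : MemLp X 2 μ)
    (H : ∀ c, 0 ≤ c → tailSq μ X c ≤ ∫ x, max (X x - c) 0 ∂μ) {t u : ℝ} (ht : 0 ≤ t)
    (hu : 0 ≤ u) : (1 + u) * tailSq μ X t ≤ tailSq μ X (t - u) := by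
  have h1 : tailSq μ X t + u * ∫ x, max (X x - t) 0 ∂μ ≤ tailSq μ X (t - u) := by
    rw [← integral_const_mul, tailSq, ← integral_add (integrable_tailSq hX t)
      ((integrable_tail hX t).const_mul u)]
    refine integral_mono ((integrable_tailSq hX t).add ((integrable_tail hX t).const_mul u))
      (integrable_tailSq hX _) fun x => ?_
    dsimp only
    rcases le_total (X x - t) 0 with h | h
    · rw [max_eq_right h]
      have := sq_nonneg (max (X x - (t - u)) 0)
      simp; positivity
    · rw [max_eq_left h, max_eq_left (by linarith)]
      nlinarith
  have := mul_le_mul_of_nonneg_left (H t ht) hu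
  linarith

/-- Exponential decay of the tail. -/
theorem exp_mul_tailSq_le (hX : MemLp X 2 μ)
    (H : ∀ c, 0 ≤ c → tailSq μ X c ≤ ∫ x, max (X x - c) 0 ∂μ) {s t : ℝ} (hs : 0 ≤ s)
    (hst : s ≤ t) : Real.exp (t - s) * tailSq μ X t ≤ tailSq μ X s := by
  -- Go from t down to s in n equal steps; the accumulated factor (1 + (t - s)/n)^n tends to the
  -- exponential.
  have key : ∀ n : ℕ, 0 < n → (1 + (t - s) / n) ^ n * tailSq μ X t ≤ tailSq μ X s := by
    intro n hn
    have hn' : (0 : ℝ) < n := by exact_mod_cast hn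
    set u := (t - s) / n with hu
    have hu0 : 0 ≤ u := div_nonneg (by linarith) hn'.le
    have hnu : n * u = t - s := by rw [hu]; field_simp
    have ind : ∀ k : ℕ, k ≤ n → (1 + u) ^ k * tailSq μ X t ≤ tailSq μ X (t - k * u) := by
      intro k
      induction k with
      | zero => intro _; simp
      | succ k ih =>
        intro hk
        have hk' : ((k : ℝ) + 1) * u ≤ t - s := by
          rw [← hnu]; gcongr; exact_mod_cast hk
        have h1 := ih (by omega)
        have h2 := one_add_mul_tailSq_le hX H (t := t - k * u) (u := u) (by linarith) hu0
        calc (1 + u) ^ (k + 1) * tailSq μ X t = (1 + u) * ((1 + u) ^ k * tailSq μ X t) := by ring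
          _ ≤ (1 + u) * tailSq μ X (t - k * u) := by gcongr
          _ ≤ tailSq μ X (t - k * u - u) := h2
          _ = _ := by push_cast; ring_nf
    have := ind n le_rfl
    rwa [hnu, sub_sub_cancel] at this
  refine le_of_tendsto ((Real.tendsto_one_add_div_pow_exp (t - s)).mul_const (tailSq μ X t)) ?_
  filter_upwards [eventually_gt_atTop 0] with n hn
  exact key n hn

/-! ### Powers as mixtures of truncated squares -/

theorem lintegral_rpow_mul_tail_sq {r : ℝ} (hr : 2 < r) {x : ℝ} (hx : 0 ≤ x) :
    ∫⁻ c in Ioi (0 : ℝ), ENNReal.ofReal (c ^ (r - 3) * (max (x - c) 0 ^ 2 / 2)) =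
      ENNReal.ofReal (x ^ r / (r * (r - 1) * (r - 2))) := by
  have hz : ∫⁻ c in Ioi x, ENNReal.ofReal (c ^ (r - 3) * (max (x - c) 0 ^ 2 / 2)) = 0 := by
    rw [setLIntegral_congr_fun (g := fun _ => 0) measurableSet_Ioi]
    · simp
    · intro c hc
      have : x - c ≤ 0 := by have := mem_Ioi.1 hc; linarith
      simp [max_eq_right this]
  rw [← Ioc_union_Ioi_eq_Ioi hx, lintegral_union measurableSet_Ioi
    (Ioc_disjoint_Ioi le_rfl), hz, add_zero]
  have heq : ∀ c ∈ Ioc 0 x, c ^ (r - 3) * (max (x - c) 0 ^ 2 / 2) =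
      x ^ 2 / 2 * c ^ (r - 3) - x * c ^ (r - 2) + 1 / 2 * c ^ (r - 1) := by
    intro c hc
    rw [max_eq_left (by linarith [hc.2]), show r - 2 = (r - 3) + 1 by ring,
      show r - 1 = (r - 3) + 2 by ring, Real.rpow_add hc.1, Real.rpow_add hc.1]
    norm_num
    ring
  have i1 := (intervalIntegral.intervalIntegrable_rpow' (a := 0) (b := x)
    (r := r - 3) (by linarith)).const_mul (x ^ 2 / 2)
  have i2 := (intervalIntegral.intervalIntegrable_rpow' (a := 0) (b := x)
    (r := r - 2) (by linarith)).const_mul x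
  have i3 := (intervalIntegral.intervalIntegrable_rpow' (a := 0) (b := x)
    (r := r - 1) (by linarith)).const_mul (1 / 2)
  have hint := (i1.sub i2).add i3
  rw [← ofReal_integral_eq_lintegral_ofReal]
  · congr 1
    rw [setIntegral_congr_fun measurableSet_Ioc heq, ← intervalIntegral.integral_of_le hx,
      intervalIntegral.integral_add (i1.sub i2) i3, intervalIntegral.integral_sub i1 i2]
    simp only [intervalIntegral.integral_const_mul]
    rw [integral_rpow (Or.inl (by linarith)), integral_rpow (Or.inl (by linarith)),
      integral_rpow (Or.inl (by linarith))]
    have e1 : r - 3 + 1 = r - 2 := by ring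
    have e2 : r - 2 + 1 = r - 1 := by ring
    have e3 : r - 1 + 1 = r := by ring
    rw [e1, e2, e3, Real.zero_rpow (by linarith), Real.zero_rpow (by linarith),
      Real.zero_rpow (by linarith)]
    rcases hx.eq_or_lt with rfl | hx
    · simp [Real.zero_rpow (show r ≠ 0 by linarith)]
    · have e4 : x ^ (r - 2) = x ^ r / x ^ 2 := by
        rw [Real.rpow_sub hx]; norm_num
      have e5 : x ^ (r - 1) = x ^ r / x := by
        rw [Real.rpow_sub hx]; norm_num
      have : r - 2 ≠ 0 := by linarith
      have : r - 1 ≠ 0 := by linarith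
      have : r ≠ 0 := by linarith
      rw [e4, e5]
      field_simp
      ring
  · refine IntegrableOn.congr_fun ?_ (fun c hc => (heq c hc).symm) measurableSet_Ioc
    exact ((intervalIntegrable_iff_integrableOn_Ioc_of_le hx).1 hint)
  · rw [EventuallyLE, ae_restrict_iff' measurableSet_Ioc]
    refine ae_of_all _ fun c hc => ?_
    have := hc.1
    dsimp only [Pi.zero_apply]
    positivity

/-- For p < 2 the weight c^(p-3) is too singular at 0 to integrate the truncated square itself.
Subtracting from its value at c = 0 leaves a difference of order c near 0, integrable as p > 1, and
constant beyond x, integrable as p < 2. -/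
theorem lintegral_rpow_mul_sq_sub_tail_sq {p : ℝ} (hp : 1 < p) (hp2 : p < 2) {x : ℝ}
    (hx : 0 ≤ x) :
    ∫⁻ c in Ioi (0 : ℝ), ENNReal.ofReal (c ^ (p - 3) * (x ^ 2 / 2 - max (x - c) 0 ^ 2 / 2)) =
      ENNReal.ofReal (x ^ p / (p * (p - 1) * (2 - p))) := by
  rcases hx.eq_or_lt with rfl | hx
  · rw [setLIntegral_congr_fun (g := fun _ => 0) measurableSet_Ioi]
    · rw [Real.zero_rpow (by linarith)]; simp
    · intro c hc
      have : 0 - c ≤ 0 := by have := mem_Ioi.1 hc; linarith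
      simp only [max_eq_right this]
      simp
  have h2 : ∫⁻ c in Ioi x, ENNReal.ofReal (c ^ (p - 3) * (x ^ 2 / 2 - max (x - c) 0 ^ 2 / 2)) =
      ENNReal.ofReal (x ^ p / (2 * (2 - p))) := by
    have heq : ∀ c ∈ Ioi x, c ^ (p - 3) * (x ^ 2 / 2 - max (x - c) 0 ^ 2 / 2) =
        x ^ 2 / 2 * c ^ (p - 3) := by
      intro c hc
      have : x - c ≤ 0 := by have := mem_Ioi.1 hc; linarith
      rw [max_eq_right this]; ring
    rw [← ofReal_integral_eq_lintegral_ofReal]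
    · rw [setIntegral_congr_fun measurableSet_Ioi heq, integral_const_mul,
        integral_Ioi_rpow_of_lt (by linarith) hx]
      congr 1
      have e4 : x ^ (p - 3 + 1) = x ^ p / x ^ 2 := by
        rw [show p - 3 + 1 = p - 2 by ring, Real.rpow_sub hx]; norm_num
      have : 2 - p ≠ 0 := by linarith
      have : p - 3 + 1 ≠ 0 := by linarith
      rw [e4]
      field_simp
      ring
    · exact IntegrableOn.congr_fun ((integrableOn_Ioi_rpow_of_lt (by linarith) hx).const_mul _)
        (fun c hc => (heq c hc).symm) measurableSet_Ioi
    · rw [EventuallyLE, ae_restrict_iff' measurableSet_Ioi]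
      refine ae_of_all _ fun c hc => ?_
      rw [heq c hc]
      have : 0 < c := hx.trans hc
      dsimp only [Pi.zero_apply]
      positivity
  rw [← Ioc_union_Ioi_eq_Ioi hx.le, lintegral_union measurableSet_Ioi
    (Ioc_disjoint_Ioi le_rfl), h2]
  have heq : ∀ c ∈ Ioc 0 x, c ^ (p - 3) * (x ^ 2 / 2 - max (x - c) 0 ^ 2 / 2) =
      x * c ^ (p - 2) - 1 / 2 * c ^ (p - 1) := by
    intro c hc
    rw [max_eq_left (by linarith [hc.2]), show p - 2 = (p - 3) + 1 by ring,
      show p - 1 = (p - 3) + 2 by ring, Real.rpow_add hc.1, Real.rpow_add hc.1]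
    norm_num
    ring
  have i2 := (intervalIntegral.intervalIntegrable_rpow' (a := 0) (b := x)
    (r := p - 2) (by linarith)).const_mul x
  have i3 := (intervalIntegral.intervalIntegrable_rpow' (a := 0) (b := x)
    (r := p - 1) (by linarith)).const_mul (1 / 2)
  rw [← ofReal_integral_eq_lintegral_ofReal]
  · have hp1 : 0 < p - 1 := by linarith
    have hp2' : 0 < 2 - p := by linarith
    rw [setIntegral_congr_fun measurableSet_Ioc heq, ← intervalIntegral.integral_of_le hx.le,
      intervalIntegral.integral_sub i2 i3]
    simp only [intervalIntegral.integral_const_mul]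
    rw [integral_rpow (Or.inl (by linarith)), integral_rpow (Or.inl (by linarith))]
    have e2 : p - 2 + 1 = p - 1 := by ring
    have e3 : p - 1 + 1 = p := by ring
    have e5 : x ^ (p - 1) = x ^ p / x := by
      rw [Real.rpow_sub hx]; norm_num
    rw [e2, e3, Real.zero_rpow (by linarith), Real.zero_rpow (by linarith), e5]
    have hxp : 0 < x ^ p := Real.rpow_pos_of_pos hx _
    have e6 : x * ((x ^ p / x - 0) / (p - 1)) - 1 / 2 * ((x ^ p - 0) / p) =
        x ^ p * (p + 1) / (2 * p * (p - 1)) := by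
      field_simp; ring
    rw [e6, ← ENNReal.ofReal_add (by positivity) (by positivity)]
    congr 1
    field_simp
    ring
  · refine IntegrableOn.congr_fun ?_ (fun c hc => (heq c hc).symm) measurableSet_Ioc
    exact ((intervalIntegrable_iff_integrableOn_Ioc_of_le hx.le).1 (i2.sub i3))
  · rw [EventuallyLE, ae_restrict_iff' measurableSet_Ioc]
    refine ae_of_all _ fun c hc => ?_
    have := hc.1
    dsimp only [Pi.zero_apply]
    rw [max_eq_left (by linarith [hc.2])]
    have : 0 ≤ x ^ 2 / 2 - (x - c) ^ 2 / 2 := by nlinarith [hc.2]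
    positivity

/-- The model case T(c) = e^(-c) of the regularised formula, which supplies the constant. Write 1 -
e^(-t) as the integral of e^(-s) over (0, t) and exchange the integrals. -/
theorem lintegral_rpow_mul_one_sub_exp {p : ℝ} (hp : 1 < p) (hp2 : p < 2) :
    ∫⁻ t in Ioi (0 : ℝ), ENNReal.ofReal (t ^ (p - 3) * (1 - Real.exp (-t))) =
      ENNReal.ofReal (Real.Gamma (p - 1) / (2 - p)) := by
  have inner : ∀ t ∈ Ioi (0 : ℝ), ENNReal.ofReal (t ^ (p - 3) * (1 - Real.exp (-t))) =
      ∫⁻ s in Ioi (0 : ℝ), (Ioi s).indicator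
        (fun t => ENNReal.ofReal (t ^ (p - 3) * Real.exp (-s))) t := by
    intro t ht
    have ht : 0 < t := ht
    have : ∀ s, (Ioi s).indicator (fun t => ENNReal.ofReal (t ^ (p - 3) * Real.exp (-s))) t =
        (Iio t).indicator (fun s => ENNReal.ofReal (t ^ (p - 3) * Real.exp (-s))) s := by
      intro s
      by_cases h : s < t <;> simp [h]
    simp_rw [this]
    rw [setLIntegral_indicator measurableSet_Iio, inter_comm, Ioi_inter_Iio,
      ← ofReal_integral_eq_lintegral_ofReal]
    · congr 1
      rw [integral_const_mul, ← integral_Ioc_eq_integral_Ioo,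
        ← intervalIntegral.integral_of_le ht.le]
      simp
    · exact ((Continuous.integrableOn_Icc (by fun_prop)).mono_set Ioo_subset_Icc_self)
    · exact ae_of_all _ fun s => by dsimp only [Pi.zero_apply]; positivity
  rw [setLIntegral_congr_fun measurableSet_Ioi inner, lintegral_lintegral_swap]
  · have outer : ∀ s ∈ Ioi (0 : ℝ), ∫⁻ t in Ioi (0 : ℝ), (Ioi s).indicator
        (fun t => ENNReal.ofReal (t ^ (p - 3) * Real.exp (-s))) t =
        ENNReal.ofReal (Real.exp (-s) * s ^ (p - 1 - 1) / (2 - p)) := by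
      intro s hs
      have hs : 0 < s := hs
      rw [setLIntegral_indicator measurableSet_Ioi, Ioi_inter_Ioi, sup_eq_left.2 hs.le,
        ← ofReal_integral_eq_lintegral_ofReal]
      · rw [integral_mul_const, integral_Ioi_rpow_of_lt (by linarith) hs]
        congr 1
        rw [show p - 3 + 1 = p - 1 - 1 by ring]
        have : 2 - p ≠ 0 := by linarith
        have : p - 1 - 1 ≠ 0 := by linarith
        field_simp
        ring
      · exact (integrableOn_Ioi_rpow_of_lt (by linarith) hs).mul_const _
      · rw [EventuallyLE, ae_restrict_iff' measurableSet_Ioi]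
        refine ae_of_all _ fun t ht => ?_
        have : 0 < t := hs.trans ht
        dsimp only [Pi.zero_apply]; positivity
    rw [setLIntegral_congr_fun measurableSet_Ioi outer, ← ofReal_integral_eq_lintegral_ofReal]
    · rw [integral_div, Real.Gamma_eq_integral (by linarith)]
    · exact (Real.GammaIntegral_convergent (by linarith)).div_const _
    · rw [EventuallyLE, ae_restrict_iff' measurableSet_Ioi]
      refine ae_of_all _ fun t ht => ?_
      have : 0 < t := ht
      have : 0 < 2 - p := by linarith
      dsimp only [Pi.zero_apply]; positivity
  · apply Measurable.aemeasurable
    have : (Function.uncurry fun t s => (Ioi s).indicator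
        (fun t => ENNReal.ofReal (t ^ (p - 3) * Real.exp (-s))) t) =
        {z : ℝ × ℝ | z.2 < z.1}.indicator
          (fun z => ENNReal.ofReal (z.1 ^ (p - 3) * Real.exp (-z.2))) := by
      ext ⟨t, s⟩
      by_cases h : s < t <;> simp [Function.uncurry, h]
    rw [this]
    exact Measurable.indicator (by fun_prop) (measurableSet_lt measurable_snd measurable_fst)

theorem lintegral_lintegral_comp_swap (hX : AEMeasurable X μ) {g : ℝ × ℝ → ℝ≥0∞}
    (hg : Measurable g) :
    ∫⁻ x, (∫⁻ c in Ioi (0 : ℝ), g (X x, c)) ∂μ = ∫⁻ c in Ioi (0 : ℝ), ∫⁻ x, g (X x, c) ∂μ := by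
  apply lintegral_lintegral_swap
  have h1 : AEMeasurable (fun z : α × ℝ => X z.1) (μ.prod (volume.restrict (Ioi 0))) :=
    hX.comp_quasiMeasurePreserving Measure.quasiMeasurePreserving_fst
  exact hg.comp_aemeasurable (h1.prodMk measurable_snd.aemeasurable)

/-- Moments of order above two as weighted integrals of the tail. -/
theorem lintegral_rpow_eq_tailSq (hX : MemLp X 2 μ) (hX0 : ∀ x, 0 ≤ X x) {r : ℝ} (hr : 2 < r) :
    ∫⁻ x, ENNReal.ofReal (X x ^ r / (r * (r - 1) * (r - 2))) ∂μ =
      ∫⁻ c in Ioi (0 : ℝ), ENNReal.ofReal (c ^ (r - 3) * tailSq μ X c) := by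
  simp_rw [← fun x => lintegral_rpow_mul_tail_sq hr (hX0 x)]
  rw [lintegral_lintegral_comp_swap hX.aestronglyMeasurable.aemeasurable
    (g := fun z => ENNReal.ofReal (z.2 ^ (r - 3) * (max (z.1 - z.2) 0 ^ 2 / 2))) (by fun_prop)]
  refine setLIntegral_congr_fun measurableSet_Ioi fun c hc => ?_
  have hc : 0 < c := hc
  dsimp only
  rw [tailSq, ← integral_const_mul, ofReal_integral_eq_lintegral_ofReal]
  · exact (integrable_tailSq hX c).const_mul _
  · exact ae_of_all _ fun x => by dsimp only [Pi.zero_apply]; positivity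

theorem lintegral_rpow_eq_tailSq_sub (hX : MemLp X 2 μ) (hX0 : ∀ x, 0 ≤ X x) {p : ℝ}
    (hp : 1 < p) (hp2 : p < 2) :
    ∫⁻ x, ENNReal.ofReal (X x ^ p / (p * (p - 1) * (2 - p))) ∂μ =
      ∫⁻ c in Ioi (0 : ℝ), ENNReal.ofReal (c ^ (p - 3) * (tailSq μ X 0 - tailSq μ X c)) := by
  simp_rw [← fun x => lintegral_rpow_mul_sq_sub_tail_sq hp hp2 (hX0 x)]
  rw [lintegral_lintegral_comp_swap hX.aestronglyMeasurable.aemeasurable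
    (g := fun z => ENNReal.ofReal (z.2 ^ (p - 3) * (z.1 ^ 2 / 2 - max (z.1 - z.2) 0 ^ 2 / 2)))
    (by fun_prop)]
  refine setLIntegral_congr_fun measurableSet_Ioi fun c hc => ?_
  have hc : 0 < c := hc
  have hsq : Integrable (fun x => X x ^ 2 / 2) μ := hX.integrable_sq.div_const 2
  dsimp only
  rw [tailSq_zero hX0, tailSq, ← integral_sub hsq (integrable_tailSq hX c), ← integral_const_mul,
    ofReal_integral_eq_lintegral_ofReal]
  · exact (hsq.sub (integrable_tailSq hX c)).const_mul _
  · refine ae_of_all _ fun x => ?_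
    dsimp only [Pi.zero_apply]
    have : max (X x - c) 0 ^ 2 ≤ X x ^ 2 := by
      gcongr
      exact max_le (by linarith) (hX0 x)
    have : 0 ≤ X x ^ 2 / 2 - max (X x - c) 0 ^ 2 / 2 := by linarith
    positivity


/-! ### Gamma laws and monotonicity of normalised moments -/

theorem Gamma_add_one_eq {q : ℝ} (hq : 2 < q) :
    Real.Gamma (q + 1) = q * (q - 1) * (q - 2) * Real.Gamma (q - 2) := by
  rw [Real.Gamma_add_one (by linarith)]
  have h1 := Real.Gamma_add_one (s := q - 1) (by linarith)
  have h2 := Real.Gamma_add_one (s := q - 2) (by linarith)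
  rw [show q - 1 + 1 = q by ring] at h1
  rw [show q - 2 + 1 = q - 1 by ring] at h2
  rw [h1, h2]; ring

/-- Dividing by Γ(q+1) normalises the weight: up to the factor e^(-c) it is the density of the Gamma
law of shape q - 2, so the right side is the mean of e^c T(c) under that law. -/
theorem lintegral_rpow_div_Gamma_eq (hX : MemLp X 2 μ) (hX0 : ∀ x, 0 ≤ X x) {q : ℝ}
    (hq : 2 < q) :
    ∫⁻ x, ENNReal.ofReal (X x ^ q / Real.Gamma (q + 1)) ∂μ =
      ∫⁻ c in Ioi (0 : ℝ), ENNReal.ofReal (c ^ (q - 3) / Real.Gamma (q - 2) * tailSq μ X c) := by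
  have hG : 0 < Real.Gamma (q - 2) := Real.Gamma_pos_of_pos (by linarith)
  have h1 : ∀ x, ENNReal.ofReal (X x ^ q / Real.Gamma (q + 1)) =
      ENNReal.ofReal (Real.Gamma (q - 2))⁻¹ *
        ENNReal.ofReal (X x ^ q / (q * (q - 1) * (q - 2))) := by
    intro x
    rw [← ENNReal.ofReal_mul (by positivity), Gamma_add_one_eq hq]
    congr 1
    have : q - 2 ≠ 0 := by linarith
    have : q - 1 ≠ 0 := by linarith
    have : q ≠ 0 := by linarith
    field_simp
  have h2 : ∀ c, ENNReal.ofReal (c ^ (q - 3) / Real.Gamma (q - 2) * tailSq μ X c) =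
      ENNReal.ofReal (Real.Gamma (q - 2))⁻¹ * ENNReal.ofReal (c ^ (q - 3) * tailSq μ X c) := by
    intro c
    rw [← ENNReal.ofReal_mul (by positivity)]
    congr 1
    field_simp
  simp_rw [h1, h2]
  rw [lintegral_const_mul' _ _ ENNReal.ofReal_ne_top, lintegral_const_mul' _ _
    ENNReal.ofReal_ne_top, lintegral_rpow_eq_tailSq hX hX0 hq]

theorem integrableOn_gammaDensity {a : ℝ} (ha : 0 < a) :
    IntegrableOn (fun c : ℝ => c ^ (a - 1) / Real.Gamma a * Real.exp (-c)) (Ioi 0) := by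
  refine IntegrableOn.congr_fun ((Real.GammaIntegral_convergent ha).div_const (Real.Gamma a))
    (fun c _ => ?_) measurableSet_Ioi
  ring

theorem integral_gammaDensity {a : ℝ} (ha : 0 < a) :
    ∫ c in Ioi (0 : ℝ), c ^ (a - 1) / Real.Gamma a * Real.exp (-c) = 1 := by
  have hG : 0 < Real.Gamma a := Real.Gamma_pos_of_pos ha
  have : ∫ c in Ioi (0 : ℝ), c ^ (a - 1) / Real.Gamma a * Real.exp (-c) =
      (∫ c in Ioi (0 : ℝ), Real.exp (-c) * c ^ (a - 1)) / Real.Gamma a := by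
    rw [← integral_div]
    congr 1
    ext c
    ring
  rw [this, ← Real.Gamma_eq_integral ha, div_self hG.ne']

/-- The Gamma distributions are stochastically increasing in the shape parameter. -/
theorem integral_gammaDensity_mul_le {a b : ℝ} (ha : 0 < a) (hab : a < b) {h : ℝ → ℝ}
    (hanti : ∀ s t, 0 < s → s ≤ t → h t ≤ h s)
    (hia : IntegrableOn (fun c : ℝ => c ^ (a - 1) / Real.Gamma a * (Real.exp (-c) * h c)) (Ioi 0))
    (hib : IntegrableOn (fun c : ℝ => c ^ (b - 1) / Real.Gamma b * (Real.exp (-c) * h c))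
      (Ioi 0)) :
    ∫ c in Ioi (0 : ℝ), c ^ (b - 1) / Real.Gamma b * (Real.exp (-c) * h c) ≤
      ∫ c in Ioi (0 : ℝ), c ^ (a - 1) / Real.Gamma a * (Real.exp (-c) * h c) := by
  have hb : 0 < b := ha.trans hab
  have hGa : 0 < Real.Gamma a := Real.Gamma_pos_of_pos ha
  have hGb : 0 < Real.Gamma b := Real.Gamma_pos_of_pos hb
  have hba : 0 < b - a := by linarith
  set R := Real.Gamma b / Real.Gamma a with hR
  have hRpos : 0 < R := by positivity
  -- The point where the two densities cross; their ratio is c^(b-a) / R, which is increasing.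
  set c₀ := R ^ (1 / (b - a)) with hc₀
  have hc₀pos : 0 < c₀ := by positivity
  have hc₀pow : c₀ ^ (b - a) = R := by
    rw [hc₀, ← Real.rpow_mul hRpos.le]
    field_simp
    simp
  -- The difference of the densities and h - h(c₀) have opposite signs on each side of c₀. The h(c₀)
  -- terms cancel after integration because both densities have mass one.
  have hpt : ∀ c ∈ Ioi (0 : ℝ),
      c ^ (b - 1) / Real.Gamma b * (Real.exp (-c) * h c) +
        h c₀ * (c ^ (a - 1) / Real.Gamma a * Real.exp (-c)) ≤
      c ^ (a - 1) / Real.Gamma a * (Real.exp (-c) * h c) +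
        h c₀ * (c ^ (b - 1) / Real.Gamma b * Real.exp (-c)) := by
    intro c hc
    have hc : 0 < c := hc
    have hw : c ^ (b - 1) / Real.Gamma b - c ^ (a - 1) / Real.Gamma a =
        c ^ (a - 1) / Real.Gamma b * (c ^ (b - a) - R) := by
      rw [show b - 1 = (a - 1) + (b - a) by ring, Real.rpow_add hc, hR]
      field_simp
    have hprod : (c ^ (b - a) - R) * (h c - h c₀) ≤ 0 := by
      rcases le_total c c₀ with hle | hle
      · apply mul_nonpos_of_nonpos_of_nonneg
        · rw [← hc₀pow, sub_nonpos]; exact Real.rpow_le_rpow hc.le hle hba.le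
        · linarith [hanti c c₀ hc hle]
      · apply mul_nonpos_of_nonneg_of_nonpos
        · rw [← hc₀pow, sub_nonneg]; exact Real.rpow_le_rpow hc₀pos.le hle hba.le
        · linarith [hanti c₀ c hc₀pos hle]
    have : (c ^ (b - 1) / Real.Gamma b - c ^ (a - 1) / Real.Gamma a) *
        (Real.exp (-c) * (h c - h c₀)) ≤ 0 := by
      rw [hw]
      have h1 : 0 ≤ c ^ (a - 1) / Real.Gamma b * Real.exp (-c) := by positivity
      have := mul_nonpos_of_nonneg_of_nonpos h1 hprod
      calc _ = c ^ (a - 1) / Real.Gamma b * Real.exp (-c) *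
            ((c ^ (b - a) - R) * (h c - h c₀)) := by ring
        _ ≤ 0 := this
    linarith
  have ja := (integrableOn_gammaDensity ha).const_mul (h c₀)
  have jb := (integrableOn_gammaDensity hb).const_mul (h c₀)
  have := setIntegral_mono_on (hib.add ja) (hia.add jb) measurableSet_Ioi hpt
  simp only [Pi.add_apply] at this
  rw [integral_add hib ja, integral_add hia jb, integral_const_mul, integral_const_mul,
    integral_gammaDensity ha, integral_gammaDensity hb] at this
  linarith

theorem exp_mul_tailSq_antitone (hX : MemLp X 2 μ)
    (H : ∀ c, 0 ≤ c → tailSq μ X c ≤ ∫ x, max (X x - c) 0 ∂μ) {s t : ℝ} (hs : 0 ≤ s)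
    (hst : s ≤ t) : Real.exp t * tailSq μ X t ≤ Real.exp s * tailSq μ X s := by
  have := mul_le_mul_of_nonneg_left (exp_mul_tailSq_le hX H hs hst) (Real.exp_pos s).le
  rwa [← mul_assoc, ← Real.exp_add, add_sub_cancel] at this

theorem tailSq_le_exp_neg (hX : MemLp X 2 μ)
    (H : ∀ c, 0 ≤ c → tailSq μ X c ≤ ∫ x, max (X x - c) 0 ∂μ) {c : ℝ} (hc : 0 ≤ c) :
    tailSq μ X c ≤ Real.exp (-c) * tailSq μ X 0 := by
  have h1 := exp_mul_tailSq_antitone hX H le_rfl hc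
  have h2 := mul_le_mul_of_nonneg_left h1 (Real.exp_pos (-c)).le
  rwa [← mul_assoc, ← Real.exp_add, neg_add_cancel, Real.exp_zero, one_mul, one_mul] at h2

theorem integrableOn_rpow_mul_tailSq (hX : MemLp X 2 μ)
    (H : ∀ c, 0 ≤ c → tailSq μ X c ≤ ∫ x, max (X x - c) 0 ∂μ) {a : ℝ} (ha : 0 < a) :
    IntegrableOn (fun c : ℝ => c ^ (a - 1) / Real.Gamma a * tailSq μ X c) (Ioi 0) := by
  have hG : 0 < Real.Gamma a := Real.Gamma_pos_of_pos ha
  refine Integrable.mono' ((integrableOn_gammaDensity ha).mul_const (tailSq μ X 0)) ?_ ?_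
  · have := (antitone_tailSq hX).measurable
    exact Measurable.aestronglyMeasurable (by fun_prop)
  · rw [ae_restrict_iff' measurableSet_Ioi]
    refine ae_of_all _ fun c hc => ?_
    have hc : 0 < c := hc
    have h0 : 0 ≤ tailSq μ X c := tailSq_nonneg c
    rw [Real.norm_of_nonneg (by positivity), mul_assoc]
    gcongr
    exact tailSq_le_exp_neg hX H hc.le

theorem lintegral_rpow_div_Gamma_le_of_two_lt (hX : MemLp X 2 μ) (hX0 : ∀ x, 0 ≤ X x)
    (H : ∀ c, 0 ≤ c → tailSq μ X c ≤ ∫ x, max (X x - c) 0 ∂μ) {p r : ℝ} (hp : 2 < p)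
    (hpr : p < r) :
    ∫⁻ x, ENNReal.ofReal (X x ^ r / Real.Gamma (r + 1)) ∂μ ≤
      ∫⁻ x, ENNReal.ofReal (X x ^ p / Real.Gamma (p + 1)) ∂μ := by
  have conv : ∀ q : ℝ, 2 < q → ∫⁻ x, ENNReal.ofReal (X x ^ q / Real.Gamma (q + 1)) ∂μ =
      ENNReal.ofReal (∫ c in Ioi (0 : ℝ), c ^ (q - 2 - 1) / Real.Gamma (q - 2) *
        (Real.exp (-c) * (Real.exp c * tailSq μ X c))) ∧
      IntegrableOn (fun c => c ^ (q - 2 - 1) / Real.Gamma (q - 2) *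
        (Real.exp (-c) * (Real.exp c * tailSq μ X c))) (Ioi 0) := by
    intro q hq
    -- The exponentials are inserted to exhibit e^c T(c) as the nonincreasing function averaged
    -- against the Gamma density.
    have he : ∀ c, Real.exp (-c) * (Real.exp c * tailSq μ X c) = tailSq μ X c := by
      intro c; rw [← mul_assoc, ← Real.exp_add]; simp
    simp_rw [he]
    have hi := integrableOn_rpow_mul_tailSq hX H (a := q - 2) (by linarith)
    refine ⟨?_, hi⟩
    rw [lintegral_rpow_div_Gamma_eq hX hX0 hq, ofReal_integral_eq_lintegral_ofReal hi]
    · simp_rw [show q - 2 - 1 = q - 3 by ring]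
    · rw [EventuallyLE, ae_restrict_iff' measurableSet_Ioi]
      refine ae_of_all _ fun c hc => ?_
      have hc : 0 < c := hc
      have h0 : 0 ≤ tailSq μ X c := tailSq_nonneg c
      have hG : 0 < Real.Gamma (q - 2) := Real.Gamma_pos_of_pos (by linarith)
      dsimp only [Pi.zero_apply]
      positivity
  obtain ⟨e1, i1⟩ := conv p hp
  obtain ⟨e2, i2⟩ := conv r (hp.trans hpr)
  rw [e1, e2]
  exact ENNReal.ofReal_le_ofReal (integral_gammaDensity_mul_le (by linarith) (by linarith)
    (fun s t hs hst => exp_mul_tailSq_antitone hX H hs.le hst) i1 i2)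

/-- The comparison with q = 2, where the Gamma law degenerates to a point mass at 0. Only T(c) ≤
e^(-c) T(0) is needed. -/
theorem lintegral_rpow_div_Gamma_le_sq (hX : MemLp X 2 μ) (hX0 : ∀ x, 0 ≤ X x)
    (H : ∀ c, 0 ≤ c → tailSq μ X c ≤ ∫ x, max (X x - c) 0 ∂μ) {r : ℝ} (hr : 2 < r) :
    ∫⁻ x, ENNReal.ofReal (X x ^ r / Real.Gamma (r + 1)) ∂μ ≤
      ENNReal.ofReal (tailSq μ X 0) := by
  have hG : 0 < Real.Gamma (r - 2) := Real.Gamma_pos_of_pos (by linarith)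
  have hi := (integrableOn_gammaDensity (a := r - 2) (by linarith)).mul_const (tailSq μ X 0)
  rw [lintegral_rpow_div_Gamma_eq hX hX0 hr]
  calc _ ≤ ∫⁻ c in Ioi (0 : ℝ), ENNReal.ofReal
        (c ^ (r - 2 - 1) / Real.Gamma (r - 2) * Real.exp (-c) * tailSq μ X 0) := by
        refine setLIntegral_mono' measurableSet_Ioi fun c hc => ?_
        have hc : 0 < c := hc
        rw [show r - 2 - 1 = r - 3 by ring, mul_assoc]
        gcongr
        exact tailSq_le_exp_neg hX H hc.le
    _ = ENNReal.ofReal (tailSq μ X 0) := by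
        rw [← ofReal_integral_eq_lintegral_ofReal hi, integral_mul_const,
          integral_gammaDensity (by linarith), one_mul]
        rw [EventuallyLE, ae_restrict_iff' measurableSet_Ioi]
        refine ae_of_all _ fun c hc => ?_
        have hc : 0 < c := hc
        have h0 : 0 ≤ tailSq μ X 0 := tailSq_nonneg 0
        dsimp only [Pi.zero_apply]
        positivity

/-- For p = 1 this is `H` at c = 0. For 1 < p < 2 insert T(0) - T(c) ≥ (1 - e^(-c)) T(0) into the
regularised formula; the model integral evaluates the result. -/
theorem sq_le_lintegral_rpow_div_Gamma (hX : MemLp X 2 μ) (hX0 : ∀ x, 0 ≤ X x)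
    (H : ∀ c, 0 ≤ c → tailSq μ X c ≤ ∫ x, max (X x - c) 0 ∂μ) {p : ℝ} (hp : 1 ≤ p)
    (hp2 : p < 2) :
    ENNReal.ofReal (tailSq μ X 0) ≤ ∫⁻ x, ENNReal.ofReal (X x ^ p / Real.Gamma (p + 1)) ∂μ := by
  rcases hp.eq_or_lt with rfl | hp1
  · have hG : Real.Gamma (1 + 1) = 1 := by
      rw [Real.Gamma_add_one (by norm_num), Real.Gamma_one]; norm_num
    have h0 := H 0 le_rfl
    simp only [sub_zero, max_eq_left (hX0 _)] at h0
    refine (ENNReal.ofReal_le_ofReal h0).trans_eq ?_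
    rw [ofReal_integral_eq_lintegral_ofReal (hX.integrable one_le_two) (ae_of_all _ hX0), hG]
    simp
  have hp1' : 0 < p - 1 := by linarith
  have hp2' : 0 < 2 - p := by linarith
  have hG : 0 < Real.Gamma (p - 1) := Real.Gamma_pos_of_pos hp1'
  have hGp : Real.Gamma (p + 1) = p * (p - 1) * Real.Gamma (p - 1) := by
    rw [Real.Gamma_add_one (by linarith)]
    have h1 := Real.Gamma_add_one (s := p - 1) hp1'.ne'
    rw [sub_add_cancel] at h1
    rw [h1]; ring
  have hS0 : 0 ≤ tailSq μ X 0 := tailSq_nonneg 0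
  have e1 : ∀ x, ENNReal.ofReal (X x ^ p / Real.Gamma (p + 1)) =
      ENNReal.ofReal ((2 - p) / Real.Gamma (p - 1)) *
        ENNReal.ofReal (X x ^ p / (p * (p - 1) * (2 - p))) := by
    intro x
    rw [← ENNReal.ofReal_mul (by positivity), hGp]
    congr 1
    field_simp
  simp_rw [e1]
  rw [lintegral_const_mul' _ _ ENNReal.ofReal_ne_top, lintegral_rpow_eq_tailSq_sub hX hX0 hp1 hp2]
  calc ENNReal.ofReal (tailSq μ X 0)
      = ENNReal.ofReal ((2 - p) / Real.Gamma (p - 1)) * (ENNReal.ofReal (tailSq μ X 0) *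
        ENNReal.ofReal (Real.Gamma (p - 1) / (2 - p))) := by
        rw [← ENNReal.ofReal_mul hS0, ← ENNReal.ofReal_mul (by positivity)]
        congr 1
        field_simp
    _ = ENNReal.ofReal ((2 - p) / Real.Gamma (p - 1)) * ∫⁻ t in Ioi (0 : ℝ),
        ENNReal.ofReal (tailSq μ X 0) *
          ENNReal.ofReal (t ^ (p - 3) * (1 - Real.exp (-t))) := by
        rw [lintegral_const_mul' _ _ ENNReal.ofReal_ne_top, lintegral_rpow_mul_one_sub_exp hp1 hp2]
    _ ≤ _ := by
        gcongr ENNReal.ofReal ((2 - p) / Real.Gamma (p - 1)) * ?_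
        refine setLIntegral_mono' measurableSet_Ioi fun t ht => ?_
        have ht : 0 < t := ht
        rw [← ENNReal.ofReal_mul hS0]
        apply ENNReal.ofReal_le_ofReal
        have h1 := tailSq_le_exp_neg hX H ht.le
        have h2 : 0 ≤ t ^ (p - 3) := by positivity
        calc _ = t ^ (p - 3) * (tailSq μ X 0 - Real.exp (-t) * tailSq μ X 0) := by ring
          _ ≤ _ := by gcongr

/-- Normalised moments decrease once the tail dominates its integral. -/
theorem lintegral_rpow_div_Gamma_le (hX : MemLp X 2 μ) (hX0 : ∀ x, 0 ≤ X x)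
    (H : ∀ c, 0 ≤ c → tailSq μ X c ≤ ∫ x, max (X x - c) 0 ∂μ) {p r : ℝ} (hp : 1 ≤ p)
    (hr : max 2 p ≤ r) :
    ∫⁻ x, ENNReal.ofReal (X x ^ r / Real.Gamma (r + 1)) ∂μ ≤
      ∫⁻ x, ENNReal.ofReal (X x ^ p / Real.Gamma (p + 1)) ∂μ := by
  have hr2 : 2 ≤ r := (le_max_left _ _).trans hr
  have hpr : p ≤ r := (le_max_right _ _).trans hr
  -- T(0) is the normalised second moment and serves as the intermediate value whenever p ≤ 2 ≤ r.
  have upper : ∫⁻ x, ENNReal.ofReal (X x ^ r / Real.Gamma (r + 1)) ∂μ ≤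
      ENNReal.ofReal (tailSq μ X 0) := by
    rcases hr2.eq_or_lt with rfl | hr2
    · exact (lintegral_sq_div_Gamma hX hX0).le
    · exact lintegral_rpow_div_Gamma_le_sq hX hX0 H hr2
  rcases lt_trichotomy p 2 with h | rfl | h
  · exact upper.trans (sq_le_lintegral_rpow_div_Gamma hX hX0 H hp h)
  · exact upper.trans (lintegral_sq_div_Gamma hX hX0).ge
  · rcases hpr.eq_or_lt with rfl | hlt
    · exact le_rfl
    · exact lintegral_rpow_div_Gamma_le_of_two_lt hX hX0 H h hlt

end Tail

/-! ### Intervals and the quadratic seminorm -/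

theorem IsBoundedInterval.exists_Ioo {J : Set ℝ} (hJ : IsBoundedInterval J) :
    ∃ a b, a < b ∧ Ioo a b ⊆ J ∧ J ⊆ Icc a b := by
  obtain ⟨hoc, hbd, hne⟩ := hJ
  have hba := hbd.bddAbove
  have hbb := hbd.bddBelow
  obtain ⟨x, hx⟩ := hne
  have hJne : J.Nonempty := ⟨x, interior_subset hx⟩
  have hnt : ∃ y ∈ J, x < y := by
    have : ∀ᶠ y in 𝓝[>] x, y ∈ J ∧ x < y :=
      Filter.Eventually.and (mem_nhdsWithin_of_mem_nhds (mem_interior_iff_mem_nhds.1 hx))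
        self_mem_nhdsWithin
    obtain ⟨y, hy⟩ := this.exists
    exact ⟨y, hy⟩
  obtain ⟨y, hy, hxy⟩ := hnt
  refine ⟨sInf J, sSup J, ?_, ?_, fun z hz => ⟨csInf_le hbb hz, le_csSup hba hz⟩⟩
  · exact (csInf_le hbb (interior_subset hx)).trans_lt (hxy.trans_le (le_csSup hba hy))
  · intro z hz
    obtain ⟨u, hu, huz⟩ := exists_lt_of_csInf_lt hJne hz.1
    obtain ⟨v, hv, hzv⟩ := exists_lt_of_lt_csSup hJne hz.2
    exact hoc.out hu hv ⟨huz.le, hzv.le⟩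

theorem isBoundedInterval_Ioo {a b : ℝ} (hab : a < b) : IsBoundedInterval (Ioo a b) :=
  ⟨ordConnected_Ioo, Metric.isBounded_Ioo a b, by rw [interior_Ioo]; exact nonempty_Ioo.2 hab⟩

theorem ae_eq_Ioo_of_subset {a b : ℝ} {J : Set ℝ} (h1 : Ioo a b ⊆ J) (h2 : J ⊆ Icc a b) :
    J =ᵐ[volume] Ioo a b :=
  (h2.eventuallyLE.trans Ioo_ae_eq_Icc.symm.le).antisymm h1.eventuallyLE

theorem setLIntegral_sub_average_le_bmoSeminorm (φ : ℝ → ℝ) {I J : Set ℝ}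
    (hJ : IsBoundedInterval J) (hJI : J ⊆ I) :
    ∫⁻ t in J, ‖φ t - ⨍ s in J, φ s‖ₑ ^ 2 ≤ bmoSeminorm φ I ^ 2 * volume J := by
  have h2 : bmoSeminorm φ I ^ 2 = ⨆ (J : Set ℝ) (_ : IsBoundedInterval J ∧ J ⊆ I),
      ⨍⁻ t in J, ‖φ t - ⨍ s in J, φ s‖ₑ ^ 2 ∂volume := by
    rw [bmoSeminorm, ← ENNReal.rpow_natCast, ← ENNReal.rpow_mul]
    norm_num
  have h3 : ⨍⁻ t in J, ‖φ t - ⨍ s in J, φ s‖ₑ ^ 2 ∂volume ≤ bmoSeminorm φ I ^ 2 := by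
    rw [h2]
    exact le_iSup₂ (f := fun (J : Set ℝ) (_ : IsBoundedInterval J ∧ J ⊆ I) =>
      ⨍⁻ t in J, ‖φ t - ⨍ s in J, φ s‖ₑ ^ 2 ∂volume) J ⟨hJ, hJI⟩
  obtain ⟨a, b, hab, h1, h2⟩ := hJ.exists_Ioo
  have hvol : volume J = ENNReal.ofReal (b - a) := by
    rw [measure_congr (ae_eq_Ioo_of_subset h1 h2), Real.volume_Ioo]
  rw [setLAverage_eq] at h3
  rwa [ENNReal.div_le_iff] at h3
  · rw [hvol]; simpa using hab
  · rw [hvol]; exact ENNReal.ofReal_ne_top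

/-- The mean minimises the quadratic deviation, so any convenient constant may replace it when the
seminorm is bounded from above. -/
theorem integral_sub_sq_of_average {α : Type*} [MeasurableSpace α] {μ : Measure α}
    [IsFiniteMeasure μ] {φ : α → ℝ} (hφ : MemLp φ 2 μ) (k : ℝ) :
    ∫ t, (φ t - ⨍ s, φ s ∂μ) ^ 2 ∂μ ≤ ∫ t, (φ t - k) ^ 2 ∂μ := by
  have h1 : Integrable φ μ := hφ.integrable one_le_two
  have h2 := hφ.integrable_sq
  have expand : ∀ c : ℝ, ∫ t, (φ t - c) ^ 2 ∂μ =
      ∫ t, φ t ^ 2 ∂μ - 2 * c * ∫ t, φ t ∂μ + c ^ 2 * μ.real univ := by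
    intro c
    have : ∀ t, (φ t - c) ^ 2 = φ t ^ 2 - 2 * c * φ t + c ^ 2 := fun t => by ring
    simp_rw [this]
    have h3 : Integrable (fun t => φ t ^ 2 - 2 * c * φ t) μ := h2.sub (h1.const_mul _)
    rw [integral_add h3 (integrable_const _), integral_sub h2 (h1.const_mul _), integral_const_mul, integral_const, smul_eq_mul]
    ring
  have havg : μ.real univ * ⨍ s, φ s ∂μ = ∫ t, φ t ∂μ := by
    rw [← smul_eq_mul, measure_smul_average]
  rw [expand, expand, ← havg]
  have : 0 ≤ μ.real univ * (k - ⨍ s, φ s ∂μ) ^ 2 := by positivity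
  linarith

theorem lintegral_enorm_sq_eq {α : Type*} [MeasurableSpace α] {μ : Measure α} {g : α → ℝ}
    (hg : Integrable (fun t => g t ^ 2) μ) :
    ∫⁻ t, ‖g t‖ₑ ^ 2 ∂μ = ENNReal.ofReal (∫ t, g t ^ 2 ∂μ) := by
  rw [ofReal_integral_eq_lintegral_ofReal hg (ae_of_all _ fun t => sq_nonneg _)]
  refine lintegral_congr fun t => ?_
  rw [← ofReal_norm, ← ENNReal.ofReal_pow (norm_nonneg _), Real.norm_eq_abs, sq_abs]

/-- A bound for the seminorm from arbitrary comparison constants. -/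
theorem bmoSeminorm_le_one {φ : ℝ → ℝ} {a b : ℝ} {I : Set ℝ} (hI : I ⊆ Icc a b)
    (hφ : MemLp φ 2 (volume.restrict (Ioo a b)))
    (h : ∀ α β, a ≤ α → α < β → β ≤ b → ∃ k : ℝ, ∫ t in Ioo α β, (φ t - k) ^ 2 ≤ β - α) :
    bmoSeminorm φ I ≤ 1 := by
  rw [bmoSeminorm]
  refine ENNReal.rpow_le_one (iSup₂_le fun J hJ => ?_) (by norm_num)
  obtain ⟨α, β, hαβ, h1, h2⟩ := hJ.1.exists_Ioo
  rw [Measure.restrict_congr_set (ae_eq_Ioo_of_subset h1 h2)]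
  have hIcc : Icc α β ⊆ Icc a b := by
    rw [← closure_Ioo hαβ.ne]
    exact closure_minimal ((h1.trans hJ.2).trans hI) isClosed_Icc
  have haα : a ≤ α := (hIcc (left_mem_Icc.2 hαβ.le)).1
  have hβb : β ≤ b := (hIcc (right_mem_Icc.2 hαβ.le)).2
  obtain ⟨k, hk⟩ := h α β haα hαβ hβb
  have hφ' : MemLp φ 2 (volume.restrict (Ioo α β)) :=
    hφ.mono_measure (Measure.restrict_mono (Ioo_subset_Ioo haα hβb) le_rfl)
  have hle := (integral_sub_sq_of_average hφ' k).trans hk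
  have hint : Integrable (fun t => (φ t - ⨍ s in Ioo α β, φ s) ^ 2)
      (volume.restrict (Ioo α β)) := (hφ'.sub (memLp_const _)).integrable_sq
  rw [setLAverage_eq, lintegral_enorm_sq_eq hint, Real.volume_Ioo]
  exact ENNReal.div_le_of_le_mul (by rw [one_mul]; exact ENNReal.ofReal_le_ofReal hle)

/-! ### Oscillation of the extremal function -/

/-- At 0 the absolute value equals 4 (√|u| log √|u|)², which reduces the claim to the continuity of
u log u. -/
theorem continuous_mul_log_sq : Continuous fun u : ℝ => u * Real.log u ^ 2 := by
  rw [continuous_iff_continuousAt]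
  intro u
  rcases eq_or_ne u 0 with rfl | hu
  · have h1 : Continuous fun u : ℝ => 4 * (√|u| * Real.log √|u|) ^ 2 :=
      ((Real.continuous_mul_log.comp (Real.continuous_sqrt.comp continuous_abs)).pow 2).const_mul 4
    have h2 : ∀ u : ℝ, |u * Real.log u ^ 2| = 4 * (√|u| * Real.log √|u|) ^ 2 := by
      intro u
      rw [Real.log_sqrt (abs_nonneg u), Real.log_abs, mul_pow, Real.sq_sqrt (abs_nonneg u), abs_mul,
        abs_of_nonneg (sq_nonneg (Real.log u))]
      ring
    unfold ContinuousAt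
    simp only [zero_mul]
    rw [tendsto_zero_iff_abs_tendsto_zero]
    have h3 := h1.tendsto 0
    simp only [abs_zero, Real.sqrt_zero, zero_mul] at h3
    simpa [Function.comp_def, h2] using h3
  · have := Real.continuousAt_log hu
    fun_prop

theorem continuous_mul_log_add_sq (c : ℝ) : Continuous fun u : ℝ => u * (Real.log u + c) ^ 2 := by
  have : (fun u : ℝ => u * (Real.log u + c) ^ 2) =
      fun u => u * Real.log u ^ 2 + 2 * c * (u * Real.log u) + c ^ 2 * u := by
    ext u; ring
  rw [this]
  exact (continuous_mul_log_sq.add (Real.continuous_mul_log.const_mul _)).add (by fun_prop)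

/-- With L = log u + c the derivative is L² + 2L = (L + 1)² - 1, the form of (φ₀ - k)² - 1 on the
logarithmic branches for c = k - 1 and c = -k - 1. -/
theorem hasDerivAt_mul_log_add_sq (c : ℝ) {u : ℝ} (hu : u ≠ 0) :
    HasDerivAt (fun u : ℝ => u * (Real.log u + c) ^ 2) ((Real.log u + c + 1) ^ 2 - 1) u := by
  refine ((hasDerivAt_id u).mul (((Real.hasDerivAt_log hu).add_const c).pow 2)).congr_deriv ?_
  simp
  field_simp
  ring

/-- A primitive of `(phiZero - k) ^ 2 - 1` on `[-2, 2]`. -/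
noncomputable def phiZeroPrimitive (k x : ℝ) : ℝ :=
  if 1 ≤ x then -((2 - x) * (Real.log (2 - x) + (k - 1)) ^ 2)
  else if -1 ≤ x then -(k - 1) ^ 2 + (k ^ 2 - 1) * (x - 1)
  else -4 * k ^ 2 + (x + 2) * (Real.log (x + 2) + (-k - 1)) ^ 2

/-- The additive constants of the branches were chosen to make them match at 1 and at -1. -/
theorem continuous_phiZeroPrimitive (k : ℝ) : Continuous (phiZeroPrimitive k) := by
  unfold phiZeroPrimitive
  refine Continuous.if_le ?_ (Continuous.if_le ?_ ?_ continuous_const continuous_id ?_)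
    continuous_const continuous_id ?_
  · exact ((continuous_mul_log_add_sq (k - 1)).comp (continuous_const.sub continuous_id)).neg
  · fun_prop
  · exact continuous_const.add
      ((continuous_mul_log_add_sq (-k - 1)).comp (continuous_id.add continuous_const))
  · rintro x rfl
    norm_num
    ring
  · rintro x rfl
    norm_num

/-- Right derivatives suffice for the fundamental theorem of calculus and need no gluing at ±1,
since each branch includes its left junction point. -/
theorem hasDerivWithinAt_phiZeroPrimitive (k : ℝ) {x : ℝ} (hx : x ∈ Ioo (-2 : ℝ) 2) :
    HasDerivWithinAt (phiZeroPrimitive k) ((phiZero x - k) ^ 2 - 1) (Ioi x) x := by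
  rcases le_or_gt 1 x with h1 | h1
  · have hd : HasDerivAt (fun x : ℝ => -((2 - x) * (Real.log (2 - x) + (k - 1)) ^ 2))
        ((phiZero x - k) ^ 2 - 1) x := by
      refine ((hasDerivAt_mul_log_add_sq (k - 1) (u := 2 - x) (by linarith [hx.2])).comp x
        ((hasDerivAt_id x).const_sub 2)).neg.congr_deriv ?_
      simp [phiZero, h1]
      ring
    refine hd.hasDerivWithinAt.congr (fun y hy => ?_) ?_
    · have : x < y := hy
      simp [phiZeroPrimitive, h1.trans this.le]
    · simp [phiZeroPrimitive, h1]
  rcases le_or_gt (-1) x with h2 | h2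
  · have hd : HasDerivAt (fun x : ℝ => -(k - 1) ^ 2 + (k ^ 2 - 1) * (x - 1))
        ((phiZero x - k) ^ 2 - 1) x := by
      refine ((((hasDerivAt_id x).sub_const 1).const_mul (k ^ 2 - 1)).const_add
        (-(k - 1) ^ 2)).congr_deriv ?_
      simp [phiZero, h1.not_ge, h2]
    refine hd.hasDerivWithinAt.congr_of_eventuallyEq ?_ ?_
    · filter_upwards [Ioo_mem_nhdsGT h1] with y hy
      simp [phiZeroPrimitive, hy.2.not_ge, h2.trans hy.1.le]
    · simp [phiZeroPrimitive, h1.not_ge, h2]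
  · have hd : HasDerivAt (fun x : ℝ => -4 * k ^ 2 + (x + 2) * (Real.log (x + 2) + (-k - 1)) ^ 2)
        ((phiZero x - k) ^ 2 - 1) x := by
      refine (((hasDerivAt_mul_log_add_sq (-k - 1) (u := x + 2) (by linarith [hx.1])).comp x
        ((hasDerivAt_id x).add_const 2)).const_add (-4 * k ^ 2)).congr_deriv ?_
      simp [phiZero, h1.not_ge, h2.not_ge]
      ring
    refine hd.hasDerivWithinAt.congr_of_eventuallyEq ?_ ?_
    · filter_upwards [Ioo_mem_nhdsGT h2] with y hy
      have : y < 1 := by linarith [hy.2]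
      simp [phiZeroPrimitive, hy.2.not_ge, this.not_ge]
    · simp [phiZeroPrimitive, h1.not_ge, h2.not_ge]

/-- A nonpositive increment of the primitive means that (φ₀ - k)² has mean at most one on (x, y).
The choice is k = φ₀(x) + 1 if x ≥ -1, k = φ₀(y) - 1 if x < -1 and y < 1, and k = 0 if the interval
reaches both logarithmic branches; each makes the obstructing square vanish or have the right sign.
-/
theorem exists_phiZeroPrimitive_le {x y : ℝ} (hx : -2 ≤ x) (hxy : x < y) (hy : y ≤ 2) :
    ∃ k, phiZeroPrimitive k y ≤ phiZeroPrimitive k x := by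
  have hnn : ∀ u c : ℝ, 0 ≤ u → 0 ≤ u * (Real.log u + c) ^ 2 := fun u c hu => by positivity
  unfold phiZeroPrimitive
  rcases le_or_gt 1 x with h1 | h1
  · refine ⟨1 - Real.log (2 - x), ?_⟩
    rw [if_pos h1, if_pos (h1.trans hxy.le)]
    have := hnn (2 - y) (1 - Real.log (2 - x) - 1) (by linarith)
    simp at this ⊢
    linarith
  rcases le_or_gt (-1) x with h2 | h2
  · refine ⟨1, ?_⟩
    rw [if_neg h1.not_ge, if_pos h2, if_pos (h2.trans hxy.le)]
    split_ifs
    · have := hnn (2 - y) (1 - 1) (by linarith)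
      norm_num at this ⊢
      linarith
    · norm_num
  · simp only [if_neg h1.not_ge, if_neg h2.not_ge]
    rcases le_or_gt 1 y with h3 | h3
    · refine ⟨0, ?_⟩
      rw [if_pos h3]
      have := hnn (2 - y) (0 - 1) (by linarith)
      have := hnn (x + 2) (-0 - 1) (by linarith)
      linarith
    simp only [if_neg h3.not_ge]
    rcases le_or_gt (-1) y with h4 | h4
    · refine ⟨-1, ?_⟩
      rw [if_pos h4]
      have := hnn (x + 2) (- -1 - 1) (by linarith)
      norm_num at this ⊢
      linarith
    · refine ⟨Real.log (y + 2) - 1, ?_⟩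
      rw [if_neg h4.not_ge]
      have := hnn (x + 2) (-(Real.log (y + 2) - 1) - 1) (by linarith)
      have e : Real.log (y + 2) + (-(Real.log (y + 2) - 1) - 1) = 0 := by ring
      rw [e]
      linarith

theorem measurable_phiZero : Measurable phiZero := by
  unfold phiZero
  refine Measurable.ite measurableSet_Ici (by fun_prop)
    (Measurable.ite measurableSet_Ici (by fun_prop) (by fun_prop))

/-! ### Affine copies of the extremal function and their moments -/

section Rescaled

variable {κ m : ℝ}

theorem integral_phiZero_sub_sq (hκ : 0 < κ) {α β : ℝ} (hα : -2 ≤ κ * (α - m)) (hαβ : α ≤ β)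
    (hβ : κ * (β - m) ≤ 2) (k : ℝ) :
    IntegrableOn (fun t => (phiZero (κ * (t - m)) - k) ^ 2) (Ioo α β) ∧
    ∫ t in Ioo α β, (phiZero (κ * (t - m)) - k) ^ 2 =
      (phiZeroPrimitive k (κ * (β - m)) - phiZeroPrimitive k (κ * (α - m))) / κ + (β - α) := by
  set G : ℝ → ℝ := fun t => phiZeroPrimitive k (κ * (t - m)) / κ + t with hG
  have hcont : Continuous G := by
    have := continuous_phiZeroPrimitive k
    fun_prop
  have hder : ∀ t ∈ Ioo α β,
      HasDerivWithinAt G ((phiZero (κ * (t - m)) - k) ^ 2) (Ioi t) t := by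
    intro t ht
    have hmem : κ * (t - m) ∈ Ioo (-2 : ℝ) 2 := by
      constructor
      · refine hα.trans_lt ?_
        gcongr
        exact ht.1
      · refine lt_of_lt_of_le ?_ hβ
        gcongr
        exact ht.2
    have hin : HasDerivWithinAt (fun t => κ * (t - m)) (κ * 1) (Ioi t) t :=
      (((hasDerivAt_id t).sub_const m).const_mul κ).hasDerivWithinAt
    have hmaps : MapsTo (fun t => κ * (t - m)) (Ioi t) (Ioi (κ * (t - m))) := by
      intro s hs
      have hs : t < s := hs
      show κ * (t - m) < κ * (s - m)
      gcongr
    refine ((((hasDerivWithinAt_phiZeroPrimitive k hmem).comp t hin hmaps).div_const κ).add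
      (hasDerivWithinAt_id t (Ioi t))).congr_deriv ?_
    field_simp
    ring
  -- Integrability near the logarithmic singularities comes for free: the integrand is the
  -- nonnegative right derivative of a continuous function.
  have hint : IntegrableOn (fun t => (phiZero (κ * (t - m)) - k) ^ 2) (Ioc α β) :=
    intervalIntegral.integrableOn_deriv_right_of_nonneg hcont.continuousOn hder
      (fun t _ => sq_nonneg _)
  refine ⟨hint.mono_set Ioo_subset_Ioc_self, ?_⟩
  rw [← integral_Ioc_eq_integral_Ioo, ← intervalIntegral.integral_of_le hαβ,
    intervalIntegral.integral_eq_sub_of_hasDeriv_right_of_le hαβ hcont.continuousOn hder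
      ((intervalIntegrable_iff_integrableOn_Ioc_of_le hαβ).2 hint)]
  simp only [hG]
  ring

variable {a b : ℝ}

theorem memLp_phiZero (hκ : 0 < κ) (ha : κ * (a - m) = -2) (hb : κ * (b - m) = 2)
    (hab : a < b) :
    MemLp (fun t => phiZero (κ * (t - m))) 2 (volume.restrict (Ioo a b)) := by
  rw [memLp_two_iff_integrable_sq]
  · simpa [IntegrableOn] using (integral_phiZero_sub_sq hκ ha.ge hab.le hb.le 0).1
  · exact (measurable_phiZero.comp (by fun_prop)).aestronglyMeasurable

theorem bmoSeminorm_phiZero_le_one (hκ : 0 < κ) (ha : κ * (a - m) = -2) (hb : κ * (b - m) = 2)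
    (hab : a < b) {I : Set ℝ} (hI : I ⊆ Icc a b) :
    bmoSeminorm (fun t => phiZero (κ * (t - m))) I ≤ 1 := by
  refine bmoSeminorm_le_one hI (memLp_phiZero hκ ha hb hab) fun α β hα hαβ hβ => ?_
  have h1 : -2 ≤ κ * (α - m) := by rw [← ha]; gcongr
  have h2 : κ * (β - m) ≤ 2 := by rw [← hb]; gcongr
  obtain ⟨k, hk⟩ := exists_phiZeroPrimitive_le h1
    (show κ * (α - m) < κ * (β - m) by gcongr) h2
  refine ⟨k, ?_⟩
  rw [(integral_phiZero_sub_sq hκ h1 hαβ.le h2 k).2]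
  have : (phiZeroPrimitive k (κ * (β - m)) - phiZeroPrimitive k (κ * (α - m))) / κ ≤ 0 :=
    div_nonpos_of_nonpos_of_nonneg (by linarith) hκ.le
  linarith

/-- The quadratic deviations from -1 and from 1 differ by 4 φ₀, and the primitive gives them the
same integral. -/
theorem integral_phiZero (hκ : 0 < κ) (ha : κ * (a - m) = -2) (hb : κ * (b - m) = 2)
    (hab : a < b) : ∫ t in Ioo a b, phiZero (κ * (t - m)) = 0 := by
  obtain ⟨i1, e1⟩ := integral_phiZero_sub_sq hκ ha.ge hab.le hb.le 1
  obtain ⟨i2, e2⟩ := integral_phiZero_sub_sq hκ ha.ge hab.le hb.le (-1)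
  have hsub := integral_sub i2 i1
  have : ∀ t, (phiZero (κ * (t - m)) - -1) ^ 2 - (phiZero (κ * (t - m)) - 1) ^ 2 =
      4 * phiZero (κ * (t - m)) := fun t => by ring
  simp_rw [this] at hsub
  rw [integral_const_mul, e1, e2, ha, hb] at hsub
  norm_num [phiZeroPrimitive] at hsub
  exact hsub

theorem image_exp_Ioi (hκ : 0 < κ) :
    (fun s => m + (2 - Real.exp (-s)) / κ) '' Ioi 0 = Ioo (m + 1 / κ) (m + 2 / κ) := by
  ext t
  constructor
  · rintro ⟨s, hs, rfl⟩
    have h1 : Real.exp (-s) < 1 := by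
      rw [Real.exp_lt_one_iff]; simpa using hs
    have h2 := Real.exp_pos (-s)
    constructor
    · dsimp only; gcongr; linarith
    · dsimp only; gcongr; linarith
  · rintro ⟨h1, h2⟩
    have h1' : 1 < κ * (t - m) := by
      have : 1 / κ < t - m := by linarith
      rwa [div_lt_iff₀' hκ] at this
    have h2' : κ * (t - m) < 2 := by
      have : t - m < 2 / κ := by linarith
      rwa [lt_div_iff₀' hκ] at this
    refine ⟨-Real.log (2 - κ * (t - m)), ?_, ?_⟩
    · have := Real.log_neg (x := 2 - κ * (t - m)) (by linarith) (by linarith)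
      show 0 < -Real.log (2 - κ * (t - m))
      linarith
    · simp only [neg_neg]
      rw [Real.exp_log (by linarith)]
      field_simp
      ring

/-- Under t = m + (2 - e^(-s)) / κ the function becomes s and dt becomes e^(-s) ds / κ, leaving
Euler's integral for Γ(q+1). -/
theorem setLIntegral_phiZero_right (hκ : 0 < κ) {q : ℝ} (hq : 0 < q) :
    ∫⁻ t in Ioo (m + 1 / κ) (m + 2 / κ), ‖phiZero (κ * (t - m))‖ₑ ^ q =
      ENNReal.ofReal (Real.Gamma (q + 1) / κ) := by
  have hder : ∀ s ∈ Ioi (0 : ℝ), HasDerivWithinAt (fun s => m + (2 - Real.exp (-s)) / κ)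
      (Real.exp (-s) / κ) (Ioi 0) s := by
    intro s _
    refine (((((hasDerivAt_id s).neg.exp.const_sub 2).div_const κ).const_add m).congr_deriv
      ?_).hasDerivWithinAt
    simp
  have hinj : InjOn (fun s => m + (2 - Real.exp (-s)) / κ) (Ioi 0) := by
    intro s _ s' _ h
    have : Real.exp (-s) = Real.exp (-s') := by
      dsimp only at h
      field_simp at h
      linarith
    simpa using this
  rw [← image_exp_Ioi hκ, lintegral_image_eq_lintegral_abs_deriv_mul measurableSet_Ioi hder hinj]
  have heq : ∀ s ∈ Ioi (0 : ℝ), ENNReal.ofReal |Real.exp (-s) / κ| *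
      ‖phiZero (κ * (m + (2 - Real.exp (-s)) / κ - m))‖ₑ ^ q =
      ENNReal.ofReal (Real.exp (-s) * s ^ (q + 1 - 1) / κ) := by
    intro s hs
    have hs : 0 < s := hs
    have h1 : Real.exp (-s) < 1 := by
      rw [Real.exp_lt_one_iff]; linarith
    have e1 : κ * (m + (2 - Real.exp (-s)) / κ - m) = 2 - Real.exp (-s) := by
      field_simp; ring
    have e2 : phiZero (2 - Real.exp (-s)) = s := by
      rw [phiZero, if_pos (by linarith)]
      simp
    rw [e1, e2, Real.enorm_of_nonneg hs.le, ENNReal.ofReal_rpow_of_pos hs,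
      abs_of_pos (by positivity), ← ENNReal.ofReal_mul (by positivity)]
    congr 1
    rw [add_sub_cancel_right]
    ring
  rw [setLIntegral_congr_fun measurableSet_Ioi heq, ← ofReal_integral_eq_lintegral_ofReal]
  · rw [integral_div, Real.Gamma_eq_integral (by linarith)]
  · exact (Real.GammaIntegral_convergent (by linarith)).div_const _
  · rw [EventuallyLE, ae_restrict_iff' measurableSet_Ioi]
    refine ae_of_all _ fun t ht => ?_
    have : 0 < t := ht
    dsimp only [Pi.zero_apply]; positivity

theorem phiZero_neg {x : ℝ} : phiZero (-x) = -phiZero x := by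
  unfold phiZero
  split_ifs
  · linarith
  · have : x = -1 := by linarith
    subst this; norm_num
  · rw [show 2 - -x = x + 2 by ring]
  · have : x = 1 := by linarith
    subst this; norm_num
  · simp
  · linarith
  · rw [show -x + 2 = 2 - x by ring]; simp
  · linarith
  · linarith

theorem setLIntegral_phiZero (hκ : 0 < κ) (ha : κ * (a - m) = -2) (hb : κ * (b - m) = 2)
    {q : ℝ} (hq : 0 < q) :
    ∫⁻ t in Ioo a b, ‖phiZero (κ * (t - m))‖ₑ ^ q =
      ENNReal.ofReal (2 * Real.Gamma (q + 1) / κ) := by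
  have ha' : a = m - 2 / κ := by field_simp; linarith
  have hb' : b = m + 2 / κ := by field_simp; linarith
  have hk1 : 0 < 1 / κ := by positivity
  have hk2 : 2 / κ = 1 / κ + 1 / κ := by ring
  set g : ℝ → ℝ≥0∞ := fun t => ‖phiZero (κ * (t - m))‖ₑ ^ q with hg
  have hright := setLIntegral_phiZero_right (m := m) hκ hq
  have hleft : ∫⁻ t in Ioo (m - 2 / κ) (m - 1 / κ), g t =
      ENNReal.ofReal (Real.Gamma (q + 1) / κ) := by
    rw [← hright]
    have hmp : MeasurePreserving (fun t : ℝ => 2 * m - t) volume volume :=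
      Measure.measurePreserving_sub_left volume (2 * m)
    have hemb : MeasurableEmbedding (fun t : ℝ => 2 * m - t) :=
      (Homeomorph.subLeft (2 * m)).measurableEmbedding
    have := hmp.setLIntegral_comp_preimage_emb hemb g (Ioo (m - 2 / κ) (m - 1 / κ))
    rw [← this]
    have hpre : (fun t : ℝ => 2 * m - t) ⁻¹' Ioo (m - 2 / κ) (m - 1 / κ) =
        Ioo (m + 1 / κ) (m + 2 / κ) := by
      ext t
      simp only [mem_preimage, mem_Ioo]
      constructor <;> rintro ⟨h1, h2⟩ <;> constructor <;> linarith
    rw [hpre]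
    refine lintegral_congr fun t => ?_
    simp only [hg]
    rw [show κ * (2 * m - t - m) = -(κ * (t - m)) by ring, phiZero_neg, enorm_neg]
  have hmid : ∫⁻ t in Icc (m - 1 / κ) (m + 1 / κ), g t = 0 := by
    rw [setLIntegral_congr_fun (g := fun _ => 0) measurableSet_Icc]
    · simp
    · intro t ht
      have h1 : -1 ≤ κ * (t - m) := by
        have : -1 / κ ≤ t - m := by rw [neg_div]; linarith [ht.1]
        rwa [div_le_iff₀' hκ] at this
      have h2 : κ * (t - m) ≤ 1 := by
        have : t - m ≤ 1 / κ := by linarith [ht.2]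
        rwa [le_div_iff₀' hκ] at this
      have : phiZero (κ * (t - m)) = 0 := by
        unfold phiZero
        split_ifs
        · have : κ * (t - m) = 1 := by linarith
          rw [this]; norm_num
        · rfl
      simp [hg, this, hq]
  have hun : Ioo a b = Ioo (m - 2 / κ) (m - 1 / κ) ∪
      (Icc (m - 1 / κ) (m + 1 / κ) ∪ Ioo (m + 1 / κ) (m + 2 / κ)) := by
    rw [ha', hb', Icc_union_Ioo_eq_Ico (by linarith) (by linarith), Ioo_union_Ico_eq_Ioo
      (by linarith) (by linarith)]
  have hd1 : Disjoint (Icc (m - 1 / κ) (m + 1 / κ)) (Ioo (m + 1 / κ) (m + 2 / κ)) :=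
    Set.disjoint_left.2 fun t h1 h2 => absurd h1.2 (not_le.2 h2.1)
  have hd2 : Disjoint (Ioo (m - 2 / κ) (m - 1 / κ))
      (Icc (m - 1 / κ) (m + 1 / κ) ∪ Ioo (m + 1 / κ) (m + 2 / κ)) := by
    rw [Icc_union_Ioo_eq_Ico (by linarith) (by linarith)]
    exact Set.disjoint_left.2 fun t h1 h2 => absurd h1.2 (not_lt.2 h2.1)
  have hG : 0 < Real.Gamma (q + 1) := Real.Gamma_pos_of_pos (by linarith)
  rw [hun, lintegral_union (measurableSet_Icc.union measurableSet_Ioo) hd2,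
    lintegral_union measurableSet_Ioo hd1, hleft, hmid, hright, zero_add,
    ← ENNReal.ofReal_add (by positivity) (by positivity)]
  congr 1
  ring

end Rescaled

/-! ### From oscillation to the moment inequality -/

/-- For c ≥ 0 at most one of y - c and -y - c is positive, so the two signs can be treated
separately. The shift by c + 1 compensates the shift by one inside `excess`. -/
theorem excess_abs_sub {c : ℝ} (hc : 0 ≤ c) (y : ℝ) :
    max (|y| - c) 0 ^ 2 / 2 - max (|y| - c) 0 = excess (y - (c + 1)) + excess (-y - (c + 1)) := by
  unfold excess
  rw [show y - (c + 1) + 1 = y - c by ring, show -y - (c + 1) + 1 = -y - c by ring]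
  rcases le_total 0 y with h | h
  · rw [abs_of_nonneg h, max_eq_right (show -y - c ≤ 0 by linarith)]; ring
  · rw [abs_of_nonpos h, max_eq_right (show y - c ≤ 0 by linarith)]; ring

/-- The weak-type inequality for the tails of a mean-zero function whose oscillation on
subintervals is at most `N`. -/
theorem tailSq_le_of_oscillation {φ : ℝ → ℝ} {a b N : ℝ} (hab : a < b) (hN : 0 < N)
    (hφ : MemLp φ 2 (volume.restrict (Ioo a b))) (hmean : ∫ t in Ioo a b, φ t = 0)
    (hosc : ∀ α β, a ≤ α → α < β → β ≤ b → ∀ c, ∫ t in Ioo α β, φ t = c * (β - α) →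
      ∫ t in Ioo α β, (φ t - c) ^ 2 ≤ N ^ 2 * (β - α)) {c : ℝ} (hc : 0 ≤ c) :
    tailSq (volume.restrict (Ioo a b)) (fun t => |φ t / N|) c ≤
      ∫ t in Ioo a b, max (|φ t / N| - c) 0 := by
  -- Used for l = ±1/N. The function l φ - (c + 1) has mean -(c + 1) ≤ 0; where it has mean zero, φ
  -- has mean (c + 1)/l, and `hosc` bounds its quadratic mean by l² N² = 1.
  have key : ∀ l : ℝ, l ^ 2 * N ^ 2 = 1 → ∫ t in Ioo a b, excess (l * φ t - (c + 1)) ≤ 0 ∧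
      IntegrableOn (fun t => excess (l * φ t - (c + 1))) (Ioo a b) := by
    intro l hl
    have hl0 : l ≠ 0 := by rintro rfl; norm_num at hl
    have hψ : MemLp (fun t => l * φ t - (c + 1)) 2 (volume.restrict (Ioo a b)) :=
      (hφ.const_mul l).sub (memLp_const _)
    have h1 : IntegrableOn (fun t => l * φ t - (c + 1)) (Ioo a b) := hψ.integrable one_le_two
    have hφ1 : IntegrableOn φ (Ioo a b) := hφ.integrable one_le_two
    have hmeanψ : ∀ α β, a ≤ α → α ≤ β → β ≤ b → ∫ t in Ioo α β, (l * φ t - (c + 1)) =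
        l * (∫ t in Ioo α β, φ t) - (c + 1) * (β - α) := by
      intro α β hα hαβ hβ
      have hsub : Ioo α β ⊆ Ioo a b := Ioo_subset_Ioo hα hβ
      rw [integral_sub ((hφ1.mono_set hsub).const_mul l) (integrable_const _), integral_const_mul]
      simp [Real.volume_real_Ioo_of_le hαβ]
      ring
    refine ⟨setIntegral_excess_nonpos hab.le h1 hψ.integrable_sq ?_ ?_,
      integrable_excess h1 hψ.integrable_sq⟩
    · rw [hmeanψ a b le_rfl hab.le le_rfl, hmean]
      have : 0 ≤ (c + 1) * (b - a) := mul_nonneg (by linarith) (by linarith)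
      linarith
    · intro α β hα hαβ hβ hz
      rw [hmeanψ α β hα hαβ.le hβ] at hz
      have h2 := hosc α β hα hαβ hβ ((c + 1) / l) (by field_simp; linarith)
      have h3 : ∀ t, (l * φ t - (c + 1)) ^ 2 = l ^ 2 * (φ t - (c + 1) / l) ^ 2 := by
        intro t; field_simp
      simp_rw [h3]
      rw [integral_const_mul]
      calc _ ≤ l ^ 2 * (N ^ 2 * (β - α)) := by gcongr
        _ = β - α := by rw [← mul_assoc, hl, one_mul]
  obtain ⟨k1, i1⟩ := key (1 / N) (by field_simp)
  obtain ⟨k2, i2⟩ := key (-(1 / N)) (by field_simp)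
  have hX : MemLp (fun t => |φ t / N|) 2 (volume.restrict (Ioo a b)) := by
    simpa only [div_eq_mul_inv, Real.norm_eq_abs] using (hφ.mul_const N⁻¹).norm
  have hsub := integral_sub (integrable_tailSq hX c) (integrable_tail hX c)
  simp_rw [excess_abs_sub hc] at hsub
  have e : ∀ t, excess (φ t / N - (c + 1)) + excess (-(φ t / N) - (c + 1)) =
      excess (1 / N * φ t - (c + 1)) + excess (-(1 / N) * φ t - (c + 1)) := by
    intro t
    rw [show φ t / N = 1 / N * φ t by ring, neg_mul]
  simp_rw [e] at hsub
  rw [integral_add i1 i2] at hsub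
  unfold tailSq
  linarith

/-- The moment inequality in integral form. -/
theorem lintegral_rpow_le_of_oscillation {φ : ℝ → ℝ} {a b N : ℝ} (hab : a < b) (hN : 0 < N)
    (hφ : MemLp φ 2 (volume.restrict (Ioo a b))) (hmean : ∫ t in Ioo a b, φ t = 0)
    (hosc : ∀ α β, a ≤ α → α < β → β ≤ b → ∀ c, ∫ t in Ioo α β, φ t = c * (β - α) →
      ∫ t in Ioo α β, (φ t - c) ^ 2 ≤ N ^ 2 * (β - α)) {p r : ℝ} (hp : 1 ≤ p)
    (hr : max 2 p ≤ r) :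
    ∫⁻ t in Ioo a b, ‖φ t‖ₑ ^ r ≤
      ENNReal.ofReal (Real.Gamma (r + 1) / Real.Gamma (p + 1)) * ENNReal.ofReal N ^ (r - p) *
        ∫⁻ t in Ioo a b, ‖φ t‖ₑ ^ p := by
  have hX : MemLp (fun t => |φ t / N|) 2 (volume.restrict (Ioo a b)) := by
    simpa only [div_eq_mul_inv, Real.norm_eq_abs] using (hφ.mul_const N⁻¹).norm
  have hr2 : 2 ≤ r := (le_max_left _ _).trans hr
  have main := lintegral_rpow_div_Gamma_le hX (fun t => abs_nonneg _)
    (fun c hc => tailSq_le_of_oscillation hab hN hφ hmean hosc hc) hp hr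
  have conv : ∀ q : ℝ, 1 ≤ q → ∫⁻ t in Ioo a b,
      ENNReal.ofReal (|φ t / N| ^ q / Real.Gamma (q + 1)) =
      ENNReal.ofReal (N ^ q * Real.Gamma (q + 1))⁻¹ * ∫⁻ t in Ioo a b, ‖φ t‖ₑ ^ q := by
    intro q hq
    have hG : 0 < Real.Gamma (q + 1) := Real.Gamma_pos_of_pos (by linarith)
    rw [← lintegral_const_mul' _ _ ENNReal.ofReal_ne_top]
    refine lintegral_congr fun t => ?_
    rw [← ofReal_norm, ENNReal.ofReal_rpow_of_nonneg (norm_nonneg _) (by linarith),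
      ← ENNReal.ofReal_mul (by positivity), Real.norm_eq_abs, abs_div, abs_of_pos hN,
      Real.div_rpow (abs_nonneg _) hN.le]
    congr 1
    field_simp
  rw [conv r (by linarith), conv p hp] at main
  have hGr : 0 < Real.Gamma (r + 1) := Real.Gamma_pos_of_pos (by linarith)
  have hGp : 0 < Real.Gamma (p + 1) := Real.Gamma_pos_of_pos (by linarith)
  have hNr : 0 < N ^ r := Real.rpow_pos_of_pos hN r
  have hNp : 0 < N ^ p := Real.rpow_pos_of_pos hN p
  have := mul_le_mul_right main (ENNReal.ofReal (N ^ r * Real.Gamma (r + 1)))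
  rw [← mul_assoc, ← mul_assoc, ← ENNReal.ofReal_mul (by positivity),
    ← ENNReal.ofReal_mul (by positivity), mul_inv_cancel₀ (by positivity), ENNReal.ofReal_one,
    one_mul] at this
  refine this.trans_eq ?_
  rw [ENNReal.ofReal_rpow_of_pos hN, ← ENNReal.ofReal_mul (by positivity), Real.rpow_sub hN]
  congr 2
  field_simp

/-! ### The inequality for norms -/

theorem lpNormOn_eq {q : ℝ} (hq : 0 < q) (φ : ℝ → ℝ) (I : Set ℝ) :
    lpNormOn φ q I = (∫⁻ t in I, ‖φ t‖ₑ ^ q) ^ (1 / q) := by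
  rw [lpNormOn, eLpNorm_eq_lintegral_rpow_enorm_toReal (by simpa using hq)
    ENNReal.ofReal_ne_top, ENNReal.toReal_ofReal hq.le]

theorem MemBMO.memLp_two {φ : ℝ → ℝ} {I : Set ℝ} (hI : IsBoundedInterval I) (hφ : MemBMO φ I) :
    MemLp φ 2 (volume.restrict I) := by
  have hvol : volume I < ∞ := hI.2.1.measure_lt_top
  have : IsFiniteMeasure (volume.restrict I) := ⟨by simpa using hvol⟩
  have h1 := (setLIntegral_sub_average_le_bmoSeminorm φ hI subset_rfl).trans_lt
    (ENNReal.mul_lt_top (ENNReal.pow_lt_top hφ.2) hvol)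
  have h2 : MemLp (fun t => φ t - ⨍ s in I, φ s) 2 (volume.restrict I) := by
    refine ⟨hφ.1.aestronglyMeasurable.sub aestronglyMeasurable_const, ?_⟩
    rw [eLpNorm_lt_top_iff_lintegral_rpow_enorm_lt_top (by norm_num) (by norm_num)]
    simpa using h1
  have := h2.add (memLp_const (⨍ s in I, φ s))
  simpa [Pi.add_def] using this

/-- The oscillation of a function on subintervals, in terms of its seminorm. -/
theorem MemBMO.integral_sub_sq_le {φ : ℝ → ℝ} {I : Set ℝ} (hI : IsBoundedInterval I)
    (hφ : MemBMO φ I) {α β c : ℝ} (hαβ : α < β) (hsub : Ioo α β ⊆ I)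
    (hc : ∫ t in Ioo α β, φ t = c * (β - α)) :
    ∫ t in Ioo α β, (φ t - c) ^ 2 ≤ (bmoSeminorm φ I).toReal ^ 2 * (β - α) := by
  have h1 := setLIntegral_sub_average_le_bmoSeminorm φ (isBoundedInterval_Ioo hαβ) hsub
  have hβα : 0 < β - α := by linarith
  have havg : ⨍ s in Ioo α β, φ s = c := by
    rw [setAverage_eq, hc, Real.volume_real_Ioo_of_le hαβ.le, smul_eq_mul]
    field_simp
  have h2 : MemLp φ 2 (volume.restrict (Ioo α β)) :=
    (hφ.memLp_two hI).mono_measure (Measure.restrict_mono hsub le_rfl)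
  have h3 : Integrable (fun t => (φ t - c) ^ 2) (volume.restrict (Ioo α β)) :=
    (h2.sub (memLp_const c)).integrable_sq
  rw [havg, lintegral_enorm_sq_eq h3, Real.volume_Ioo, ← ENNReal.ofReal_toReal hφ.2.ne,
    ← ENNReal.ofReal_pow ENNReal.toReal_nonneg, ← ENNReal.ofReal_mul (by positivity)] at h1
  exact (ENNReal.ofReal_le_ofReal_iff (by positivity)).1 h1

theorem MemBMO.lintegral_rpow_le {φ : ℝ → ℝ} {I : Set ℝ} (hI : IsBoundedInterval I)
    (hφ : MemBMO φ I) (hmean : ⨍ t in I, φ t = 0) (hne : bmoSeminorm φ I ≠ 0) {p r : ℝ}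
    (hp : 1 ≤ p) (hr : max 2 p ≤ r) :
    ∫⁻ t in I, ‖φ t‖ₑ ^ r ≤
      ENNReal.ofReal (Real.Gamma (r + 1) / Real.Gamma (p + 1)) * bmoSeminorm φ I ^ (r - p) *
        ∫⁻ t in I, ‖φ t‖ₑ ^ p := by
  obtain ⟨a, b, hab, h1, h2⟩ := hI.exists_Ioo
  have hres := Measure.restrict_congr_set (μ := volume) (ae_eq_Ioo_of_subset h1 h2)
  have hφ2 := hφ.memLp_two hI
  rw [hres] at hφ2 ⊢
  have hmean' : ∫ t in Ioo a b, φ t = 0 := by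
    rw [hres, setAverage_eq, Real.volume_real_Ioo_of_le hab.le, smul_eq_mul] at hmean
    have : (b - a)⁻¹ ≠ 0 := inv_ne_zero (by linarith)
    exact (mul_eq_zero.1 hmean).resolve_left this
  have := lintegral_rpow_le_of_oscillation hab (ENNReal.toReal_pos hne hφ.2.ne) hφ2 hmean'
    (fun α β hα hαβ hβ c hc =>
      hφ.integral_sub_sq_le hI hαβ ((Ioo_subset_Ioo hα hβ).trans h1) hc) hp hr
  rwa [ENNReal.ofReal_toReal hφ.2.ne] at this

/-- The degenerate case, excluded from the scaled argument because it divides by the seminorm. The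
subinterval J = I already settles it. -/
theorem MemBMO.ae_eq_zero {φ : ℝ → ℝ} {I : Set ℝ} (hI : IsBoundedInterval I)
    (hφ : MemBMO φ I) (hmean : ⨍ t in I, φ t = 0) (h0 : bmoSeminorm φ I = 0) :
    φ =ᵐ[volume.restrict I] 0 := by
  have h1 := setLIntegral_sub_average_le_bmoSeminorm φ hI subset_rfl
  rw [h0, hmean] at h1
  simp only [sub_zero, ne_eq, OfNat.ofNat_ne_zero, not_false_eq_true, zero_pow, zero_mul,
    nonpos_iff_eq_zero] at h1
  rw [lintegral_eq_zero_iff' (hφ.1.aestronglyMeasurable.aemeasurable.enorm.pow_const 2)] at h1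
  filter_upwards [h1] with t ht
  simpa using ht

theorem MemBMO.memLp {φ : ℝ → ℝ} {I : Set ℝ} (hI : IsBoundedInterval I)
    (hφ : MemBMO φ I) (hmean : ⨍ t in I, φ t = 0) {r : ℝ} (hr : 2 ≤ r) :
    MemLp φ (ENNReal.ofReal r) (volume.restrict I) := by
  by_cases h0 : bmoSeminorm φ I = 0
  · exact (memLp_congr_ae (hφ.ae_eq_zero hI hmean h0)).2 MemLp.zero
  refine ⟨hφ.1.aestronglyMeasurable, ?_⟩
  rw [eLpNorm_lt_top_iff_lintegral_rpow_enorm_lt_top (by simp; linarith) ENNReal.ofReal_ne_top,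
    ENNReal.toReal_ofReal (by linarith)]
  have h2 := (hφ.memLp_two hI).2
  rw [eLpNorm_lt_top_iff_lintegral_rpow_enorm_lt_top (by norm_num) (by norm_num)] at h2
  -- Compare with the exponent 2, whose moment is known to be finite.
  refine (hφ.lintegral_rpow_le hI hmean h0 one_le_two (by simpa using hr)).trans_lt ?_
  refine ENNReal.mul_lt_top (ENNReal.mul_lt_top ENNReal.ofReal_lt_top ?_) (by simpa using h2)
  exact ENNReal.rpow_lt_top_of_nonneg (by linarith) hφ.2.ne

theorem MemBMO.lpNormOn_le {φ : ℝ → ℝ} {I : Set ℝ} (hI : IsBoundedInterval I)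
    (hφ : MemBMO φ I) (hmean : ⨍ t in I, φ t = 0) {p r : ℝ} (hp : 1 ≤ p) (hr : max 2 p ≤ r) :
    lpNormOn φ r I ≤ ENNReal.ofReal (multConst p r) *
      lpNormOn φ p I ^ (p / r) * bmoSeminorm φ I ^ (1 - p / r) := by
  have hr0 : 0 < r := by linarith [(le_max_left 2 p).trans hr]
  have hp0 : 0 < p := by linarith
  by_cases h0 : bmoSeminorm φ I = 0
  · have : lpNormOn φ r I = 0 := by
      rw [lpNormOn, eLpNorm_congr_ae (hφ.ae_eq_zero hI hmean h0), eLpNorm_zero]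
    rw [this]
    exact zero_le
  have hGr : 0 < Real.Gamma (r + 1) := Real.Gamma_pos_of_pos (by linarith)
  have hGp : 0 < Real.Gamma (p + 1) := Real.Gamma_pos_of_pos (by linarith)
  have h := hφ.lintegral_rpow_le hI hmean h0 hp hr
  rw [lpNormOn_eq hr0, lpNormOn_eq hp0, multConst,
    ← ENNReal.ofReal_rpow_of_pos (by positivity : 0 < Real.Gamma (r + 1) / Real.Gamma (p + 1))]
  have hr' : 0 ≤ 1 / r := by positivity
  refine (ENNReal.rpow_le_rpow h hr').trans_eq ?_
  rw [ENNReal.mul_rpow_of_nonneg _ _ hr', ENNReal.mul_rpow_of_nonneg _ _ hr',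
    ← ENNReal.rpow_mul, ← ENNReal.rpow_mul, mul_right_comm]
  congr 3
  · field_simp
  · field_simp

/-! ### Sharpness and equality -/

theorem memBMO_phiZero {κ m a b : ℝ} (hκ : 0 < κ) (ha : κ * (a - m) = -2) (hb : κ * (b - m) = 2)
    (hab : a < b) {I : Set ℝ} (h1 : Ioo a b ⊆ I) (h2 : I ⊆ Icc a b) :
    MemBMO (fun t => phiZero (κ * (t - m))) I ∧ ⨍ t in I, phiZero (κ * (t - m)) = 0 := by
  have hres := Measure.restrict_congr_set (μ := volume) (ae_eq_Ioo_of_subset h1 h2)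
  refine ⟨⟨?_, (bmoSeminorm_phiZero_le_one hκ ha hb hab h2).trans_lt ENNReal.one_lt_top⟩, ?_⟩
  · rw [IntegrableOn, hres]
    exact (memLp_phiZero hκ ha hb hab).integrable one_le_two
  · rw [hres, setAverage_eq, integral_phiZero hκ ha hb hab, smul_zero]

theorem lpNormOn_phiZero {κ m a b : ℝ} (hκ : 0 < κ) (ha : κ * (a - m) = -2)
    (hb : κ * (b - m) = 2) {I : Set ℝ} (h1 : Ioo a b ⊆ I) (h2 : I ⊆ Icc a b)
    {q : ℝ} (hq : 0 < q) :
    lpNormOn (fun t => phiZero (κ * (t - m))) q I =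
      ENNReal.ofReal ((2 * Real.Gamma (q + 1) / κ) ^ (1 / q)) := by
  have hG : 0 < Real.Gamma (q + 1) := Real.Gamma_pos_of_pos (by linarith)
  rw [lpNormOn_eq hq, Measure.restrict_congr_set (ae_eq_Ioo_of_subset h1 h2),
    setLIntegral_phiZero hκ ha hb hq, ENNReal.ofReal_rpow_of_pos (by positivity)]

theorem lpNormOn_phiZero_rpow {κ m a b : ℝ} (hκ : 0 < κ) (ha : κ * (a - m) = -2)
    (hb : κ * (b - m) = 2) {I : Set ℝ} (h1 : Ioo a b ⊆ I) (h2 : I ⊆ Icc a b)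
    {p r : ℝ} (hp : 0 < p) (hr : 0 < r) :
    lpNormOn (fun t => phiZero (κ * (t - m))) p I ^ (p / r) =
      ENNReal.ofReal ((2 * Real.Gamma (p + 1) / κ) ^ (1 / r)) := by
  have hG : 0 < Real.Gamma (p + 1) := Real.Gamma_pos_of_pos (by linarith)
  rw [lpNormOn_phiZero hκ ha hb h1 h2 hp, ENNReal.ofReal_rpow_of_pos (by positivity),
    ← Real.rpow_mul (by positivity)]
  congr 2
  field_simp

theorem multConst_mul_rpow {p r κ : ℝ} (hp : 0 < p) (hr : 0 < r) (hκ : 0 < κ) :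
    multConst p r * (2 * Real.Gamma (p + 1) / κ) ^ (1 / r) =
      (2 * Real.Gamma (r + 1) / κ) ^ (1 / r) := by
  have hGr : 0 < Real.Gamma (r + 1) := Real.Gamma_pos_of_pos (by linarith)
  have hGp : 0 < Real.Gamma (p + 1) := Real.Gamma_pos_of_pos (by linarith)
  rw [multConst, ← Real.mul_rpow (by positivity) (by positivity)]
  congr 1
  field_simp

end

theorem theorem1 (p r : ℝ) (hp : 1 ≤ p) (hr : max 2 p ≤ r) :
    -- the inequality, on every interval, for every mean-zero function of class BMO
    (∀ I : Set ℝ, IsBoundedInterval I → ∀ φ : ℝ → ℝ, MemBMO φ I → (⨍ t in I, φ t) = 0 →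
      MemLp φ (ENNReal.ofReal r) (volume.restrict I) ∧
      lpNormOn φ r I ≤ ENNReal.ofReal (multConst p r) *
        lpNormOn φ p I ^ (p / r) * bmoSeminorm φ I ^ (1 - p / r)) ∧
    -- sharpness: on no interval can the constant be replaced by a smaller one
    (∀ I : Set ℝ, IsBoundedInterval I → ∀ C : ℝ,
      (∀ φ : ℝ → ℝ, MemBMO φ I → (⨍ t in I, φ t) = 0 →
        lpNormOn φ r I ≤ ENNReal.ofReal C *
          lpNormOn φ p I ^ (p / r) * bmoSeminorm φ I ^ (1 - p / r)) →
      multConst p r ≤ C) ∧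
    -- the explicit nonzero function on `(-2, 2)` for which equality holds
    (MemBMO phiZero (Set.Ioo (-2) 2) ∧
      (⨍ t in Set.Ioo (-2 : ℝ) 2, phiZero t) = 0 ∧
      0 < lpNormOn phiZero r (Set.Ioo (-2) 2) ∧
      lpNormOn phiZero r (Set.Ioo (-2) 2) = ENNReal.ofReal (multConst p r) *
        lpNormOn phiZero p (Set.Ioo (-2) 2) ^ (p / r) *
        bmoSeminorm phiZero (Set.Ioo (-2) 2) ^ (1 - p / r)) := by
  have hr2 : 2 ≤ r := (le_max_left _ _).trans hr
  have hpr : p ≤ r := (le_max_right _ _).trans hr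
  have hr0 : 0 < r := by linarith
  have hp0 : 0 < p := by linarith
  have hGr : 0 < Real.Gamma (r + 1) := Real.Gamma_pos_of_pos (by linarith)
  have hGp : 0 < Real.Gamma (p + 1) := Real.Gamma_pos_of_pos (by linarith)
  have hexp : 0 ≤ 1 - p / r := by
    rw [sub_nonneg, div_le_one hr0]; exact hpr
  refine ⟨fun I hI φ hφ hmean => ⟨hφ.memLp hI hmean hr2, hφ.lpNormOn_le hI hmean hp hr⟩,
    fun I hI C hC => ?_, ?_⟩
  · obtain ⟨a, b, hab, h1, h2⟩ := hI.exists_Ioo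
    have hba : 0 < b - a := by linarith
    -- This factor, with the midpoint as centre, carries (a, b) onto (-2, 2).
    have hκ : 0 < 4 / (b - a) := by positivity
    have ha : 4 / (b - a) * (a - (a + b) / 2) = -2 := by field_simp; ring
    have hb : 4 / (b - a) * (b - (a + b) / 2) = 2 := by field_simp; ring
    obtain ⟨hbmo, hmean⟩ := memBMO_phiZero hκ ha hb hab h1 h2
    have h := hC _ hbmo hmean
    have hN := ENNReal.rpow_le_one (bmoSeminorm_phiZero_le_one hκ ha hb hab h2) hexp
    rw [lpNormOn_phiZero hκ ha hb h1 h2 hr0, lpNormOn_phiZero_rpow hκ ha hb h1 h2 hp0 hr0,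
      ← multConst_mul_rpow hp0 hr0 hκ] at h
    -- The seminorm of the test function is at most one and its exponent is nonnegative, so the
    -- factor can be dropped; its exact value is not needed.
    have h' := h.trans (mul_le_of_le_one_right' hN)
    have hA : 0 < (2 * Real.Gamma (p + 1) / (4 / (b - a))) ^ (1 / r) := by positivity
    have hM : 0 < multConst p r := by unfold multConst; positivity
    rw [ENNReal.ofReal_mul hM.le] at h'
    have h'' := (ENNReal.mul_le_mul_iff_left (by simpa using hA) ENNReal.ofReal_ne_top).1 h'
    -- Truncation by `ENNReal.ofReal` would allow the alternative `multConst p r ≤ 0`, which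
    -- positivity rules out; so negative C are covered as well.
    exact (ENNReal.ofReal_le_ofReal_iff' .. |>.1 h'').resolve_right (not_le.2 hM)
  · have ha : (1 : ℝ) * (-2 - 0) = -2 := by norm_num
    have hb : (1 : ℝ) * (2 - 0) = 2 := by norm_num
    have hfun : (fun t => phiZero (1 * (t - 0))) = phiZero := by ext t; simp
    have hI := isBoundedInterval_Ioo (show (-2 : ℝ) < 2 by norm_num)
    obtain ⟨hbmo, hmean⟩ := memBMO_phiZero one_pos ha hb (by norm_num) subset_rfl
      Set.Ioo_subset_Icc_self
    have e1 := lpNormOn_phiZero one_pos ha hb subset_rfl Set.Ioo_subset_Icc_self hr0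
    have e2 := lpNormOn_phiZero_rpow one_pos ha hb subset_rfl Set.Ioo_subset_Icc_self hp0 hr0
    have hN := ENNReal.rpow_le_one (bmoSeminorm_phiZero_le_one one_pos ha hb (by norm_num)
      Set.Ioo_subset_Icc_self) hexp
    have hmean' : ⨍ t in Set.Ioo (-2 : ℝ) 2, phiZero t = 0 := by simpa using hmean
    rw [hfun] at hbmo e1 e2 hN
    have hM : 0 < multConst p r := by unfold multConst; positivity
    -- One direction is the general inequality. The other holds because the moments already have the
    -- exact ratio and the seminorm factor is at most one.
    refine ⟨hbmo, hmean', ?_, le_antisymm (hbmo.lpNormOn_le hI hmean' hp hr) ?_⟩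
    · rw [e1, ENNReal.ofReal_pos]; positivity
    · rw [e2, ← ENNReal.ofReal_mul hM.le, multConst_mul_rpow hp0 hr0 one_pos, e1]
      exact mul_le_of_le_one_right' hN
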